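/- All graphs are finite, simple and undirected, and a graph property $\Pi$ is a set of graphs closed under isomorphism. Let $\mathrm{vc}(G)$ denote the minimum size of a vertex cover of $G$. A graph $G$ is vertex-minimal with respect to $\Pi$ if $G\in\Pi$ and $G[S]\notin\Pi$ for every $S\subsetneq V(G)$. For $c\in\mathbb N$, the property $\Pi$ is characterized by $c$ adjacencies if for every $G\in\Pi$ and every $v\in V(G)$ there is a set $D\subseteq V(G)\setminus\{v\}$ with $|D|\le c$ such that every graph obtained from $G$ by adding or removing edges between $v$ and vertices of $V(G)\setminus D$ also belongs to $\Pi$. Deletion Distance to $\Pi$-free is the following problem: an instance is a graph $G$ with a vertex cover $X$ of $G$ and an integer $k\ge 1$; the parameter is $x:=|X|$; the question is whether there is a set $S\subseteq V(G)$ with $|S|\le k$ such that $G-S$ contains no graph of $\Pi$ as an induced subgraph. A polynomial kernel for this problem is a polynomial-time algorithm that maps each instance $(G,X,k)$ to an instance $(G',X',k')$ with the same answer, such that the encoding length of $(G',X',k')$ and $|X'|$ are bounded by a polynomial in $x$. **Theorem 3.1.** Let $\Pi$ be a graph property and let $c_\Pi\in\mathbb N$ such that 1. $\Pi$ is characterized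 by $c_\Pi$ adjacencies, 2. every graph in $\Pi$ contains at least one edge, and 3. there is a non-decreasing polynomial $p\colon\mathbb N\to\mathbb N$ such that every graph $G$ that is vertex-minimal with respect to $\Pi$ satisfies $|V(G)|\le p(\mathrm{vc}(G))$. Then Deletion Distance to $\Pi$-free has a polynomial kernel with $\mathcal O\big((x+p(x))\,x^{c_\Pi}\big)$ vertices: there are a polynomial kernel and a constant $C$ such that for every instance with parameter $x=|X|$ the output graph has at most $C\,(x+p(x))\,x^{c_\Pi}$ vertices (where $0^0=1$). -/

import Mathlib

/-! ### Random-access machines with unit-cost step counting -/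

namespace VCKernel

/-- The state of a random-access machine: registers and an unbounded memory, both holding
natural numbers. -/
structure RamState where
  reg : ℕ → ℕ
  mem : ℕ → ℕ

/-- Assign a value to a register. -/
def RamState.setReg (s : RamState) (r a : ℕ) : RamState :=
  { s with reg := Function.update s.reg r a }

/-- Assign a value to a memory cell. -/
def RamState.setMem (s : RamState) (i a : ℕ) : RamState :=
  { s with mem := Function.update s.mem i a }

/-- Programs of a structured random-access machine. The only arithmetic operations are addition
and truncated subtraction (no multiplication), so that an operation lengthens the largest number
in use by at most one bit; with this instruction set, unit-cost time is polynomially related to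
Turing machine time. -/
inductive RamProg where
  /-- do nothing -/
  | skip : RamProg
  /-- `reg r := a` -/
  | const (r a : ℕ) : RamProg
  /-- `reg r := reg u + reg v` -/
  | add (r u v : ℕ) : RamProg
  /-- `reg r := reg u - reg v` (truncated at zero) -/
  | sub (r u v : ℕ) : RamProg
  /-- `reg r := mem (reg u)` -/
  | load (r u : ℕ) : RamProg
  /-- `mem (reg u) := reg r` -/
  | store (u r : ℕ) : RamProg
  /-- sequential composition -/
  | seq (P Q : RamProg) : RamProg
  /-- run `P` if `reg r ≠ 0` and `Q` otherwise -/
  | branch (r : ℕ) (P Q : RamProg) : RamProg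
  /-- while `reg r ≠ 0`, run `P` -/
  | loop (r : ℕ) (P : RamProg) : RamProg

/-- `RamExec P s s' t`: started in state `s`, the program `P` halts in state `s'` after exactly
`t` steps. Every elementary instruction and every evaluation of a test costs one step. -/
inductive RamExec : RamProg → RamState → RamState → ℕ → Prop where
  | skip (s : RamState) : RamExec .skip s s 1
  | const (r a : ℕ) (s : RamState) : RamExec (.const r a) s (s.setReg r a) 1
  | add (r u v : ℕ) (s : RamState) :
      RamExec (.add r u v) s (s.setReg r (s.reg u + s.reg v)) 1
  | sub (r u v : ℕ) (s : RamState) :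
      RamExec (.sub r u v) s (s.setReg r (s.reg u - s.reg v)) 1
  | load (r u : ℕ) (s : RamState) :
      RamExec (.load r u) s (s.setReg r (s.mem (s.reg u))) 1
  | store (u r : ℕ) (s : RamState) :
      RamExec (.store u r) s (s.setMem (s.reg u) (s.reg r)) 1
  | seq {P Q : RamProg} {s s' s'' : RamState} {t t' : ℕ} :
      RamExec P s s' t → RamExec Q s' s'' t' → RamExec (.seq P Q) s s'' (t + t')
  | branch_true {r : ℕ} {P Q : RamProg} {s s' : RamState} {t : ℕ} :
      s.reg r ≠ 0 → RamExec P s s' t → RamExec (.branch r P Q) s s' (t + 1)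
  | branch_false {r : ℕ} {P Q : RamProg} {s s' : RamState} {t : ℕ} :
      s.reg r = 0 → RamExec Q s s' t → RamExec (.branch r P Q) s s' (t + 1)
  | loop_done {r : ℕ} {P : RamProg} {s : RamState} :
      s.reg r = 0 → RamExec (.loop r P) s s 1
  | loop_step {r : ℕ} {P : RamProg} {s s' s'' : RamState} {t t' : ℕ} :
      s.reg r ≠ 0 → RamExec P s s' t → RamExec (.loop r P) s' s'' t' →
      RamExec (.loop r P) s s'' (t + t' + 1)

/-- The start state on input `w`: register `0` holds the number of words, the memory cells
`0, 1, …` hold the words, and everything else is zero. -/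
def ramInput (w : List ℕ) : RamState where
  reg := fun r => if r = 0 then w.length else 0
  mem := fun i => w.getD i 0

/-- The output convention, the same as for the input except that the registers other than `0` and
the memory cells behind the output are irrelevant. -/
def RamOutputs (s : RamState) (w : List ℕ) : Prop :=
  s.reg 0 = w.length ∧ ∀ i (h : i < w.length), s.mem i = w[i]

/-- The bit length of a list of natural numbers: every number is written in binary, followed by
one separator. -/
def bitLength (w : List ℕ) : ℕ := (w.map fun a => Nat.size a + 1).sum

/-- `f` is computable in time polynomial in the bit length of the encoded input. -/
def PolyTimeComputable {α β : Type} (encα : α → List ℕ) (encβ : β → List ℕ) (f : α → β) : Prop :=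
  ∃ (P : RamProg) (q : Polynomial ℕ), ∀ a : α, ∃ (s : RamState) (t : ℕ),
    RamExec P (ramInput (encα a)) s t ∧ t ≤ q.eval (bitLength (encα a)) ∧
      RamOutputs s (encβ (f a))

/-! ### Kernelization -/

/-- `f` is a polynomial kernelization for the problem whose instances are the elements of `α`
(written down by `enc`), whose yes-instances are given by `yes` and whose parameter is `param`:
a polynomial-time algorithm that maps each instance to an equivalent one, whose encoding length
and parameter are at most a polynomial in the parameter of the original instance. -/
structure IsPolyKernelization {α : Type} (enc : α → List ℕ) (param : α → ℕ) (yes : α → Prop)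
    (f : α → α) : Prop where
  polyTime : PolyTimeComputable enc enc f
  equivalent : ∀ a, yes (f a) ↔ yes a
  size_le : ∃ q : Polynomial ℕ, ∀ a,
    bitLength (enc (f a)) ≤ q.eval (param a) ∧ param (f a) ≤ q.eval (param a)

/-! ### Graph properties -/

/-- A graph property: a set of finite simple graphs, closed under isomorphism. -/
structure GraphProperty where
  Holds : ∀ {V : Type} [Finite V], SimpleGraph V → Prop
  iso_iff : ∀ {V W : Type} [Finite V] [Finite W] {G : SimpleGraph V} {H : SimpleGraph W},
    Nonempty (G ≃g H) → (Holds G ↔ Holds H)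

namespace GraphProperty

/-- For every graph `G` with the property and every vertex `v` there is a set `D` of at most `c`
vertices other than `v` such that every graph `G'` that is obtained from `G` by adding or removing
edges between `v` and vertices outside `D` has the property as well. -/
def CharacterizedByAdjacencies (Pr : GraphProperty) (c : ℕ) : Prop :=
  ∀ (V : Type) [Finite V] (G : SimpleGraph V), Pr.Holds G → ∀ v : V,
    ∃ D : Finset V, v ∉ D ∧ D.card ≤ c ∧
      ∀ G' : SimpleGraph V,
        (∀ u w, u ≠ v → w ≠ v → (G'.Adj u w ↔ G.Adj u w)) →
        (∀ u ∈ D, (G'.Adj v u ↔ G.Adj v u)) →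
        Pr.Holds G'

/-- `G` has the property, but no induced subgraph on a proper subset of the vertices has it. -/
def VertexMinimal (Pr : GraphProperty) {V : Type} [Finite V] (G : SimpleGraph V) : Prop :=
  Pr.Holds G ∧ ∀ S : Set V, S ≠ Set.univ → ¬ Pr.Holds (G.induce S)

/-- `G` does not contain a graph with the property as an induced subgraph. -/
def InducedFree (Pr : GraphProperty) {V : Type} (G : SimpleGraph V) : Prop :=
  ∀ (W : Type) [Finite W] (H : SimpleGraph W), Pr.Holds H → ¬ H.IsIndContained G

end GraphProperty

/-! ### The vertex-deletion problem parameterized by a given vertex cover -/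

/-- An instance: a finite graph (on the vertices `0, …, n - 1`), a vertex cover `X` of it, and an
integer `k ≥ 1`. -/
structure VCInstance where
  n : ℕ
  G : SimpleGraph (Fin n)
  X : Finset (Fin n)
  isVertexCover : G.IsVertexCover (X : Set (Fin n))
  k : ℕ
  one_le_k : 1 ≤ k

/-- The parameter: the size of the given vertex cover. -/
def VCInstance.param (I : VCInstance) : ℕ := I.X.card

open Classical in
/-- An instance is written down as `n`, `k`, the characteristic vector of `X`, and the rows of the
adjacency matrix of `G`. -/
noncomputable def VCInstance.encode (I : VCInstance) : List ℕ :=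
  I.n :: I.k :: ((List.ofFn fun i : Fin I.n => if i ∈ I.X then 1 else 0) ++
    (List.ofFn fun i : Fin I.n =>
      List.ofFn fun j : Fin I.n => if I.G.Adj i j then 1 else 0).flatten)

/-- The question: is there a set `S` of at most `k` vertices such that `G - S` does not contain a
graph with the property as an induced subgraph? -/
def DeletionToFree (Pr : GraphProperty) (I : VCInstance) : Prop :=
  ∃ S : Finset (Fin I.n), S.card ≤ I.k ∧
    Pr.InducedFree (I.G.induce ((S : Set (Fin I.n))ᶜ))

end VCKernel

/-! The kernelization marks vertices and deletes the others. Let `x` be the size of the vertex cover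
`X`. If `k ≥ x`, then `X` itself is a solution, because every graph with the property has an edge,
and the kernel is the empty instance. Otherwise all vertices of `X` are marked, and for every
`c`-tuple `y` over `X` and every pattern of adjacencies to `y`, the first `l` vertices outside `X`
with this pattern, where `l` is at least `k + p x` (`Marked`). These are at most
`x + 2 ^ c * x ^ c * l` vertices (`card_marked_le`).

The marking is safe (`GraphProperty.not_holds_of_marked`): let `S` be a solution for the marked
vertices, and let `P` be a set of vertices outside `S` that induces a graph with the property and is
chosen with minimum cardinality and, subject to that, with the fewest unmarked vertices. Then `P` is
vertex-minimal, so that it has at most `p x` vertices. If `P` has an unmarked vertex `v`, let `D` be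
the set of at most `c` vertices of `P` that determine the property at `v`. At least `k + p x` marked
vertices outside `X` have the same adjacencies as `v` to `D ∩ X`, and one of them, `u`, lies neither
in `S` nor in `P` (`exists_marked_twin`). As `X` is a vertex cover, neither `u` nor `v` has
neighbours in `D \ X`. Hence `P - v + u` induces a graph with the property
(`GraphProperty.holds_induce_exchange`), against the choice of `P`. So all of `P` is marked, which
is impossible because `S` is a solution for the marked vertices.

For the running time, the algorithm is written in a language whose loops all run over the vertices
(`Cmd`). Every command of this language compiles to a machine program that runs in time polynomial
in the number of vertices (`Cmd.exists_ramExec`), so that only the result of the algorithm has to be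
verified (`run_kernelCmd`). To avoid the evaluation of a polynomial with real coefficients, `p x` is
replaced by a monomial `A * x ^ d` of the same order of magnitude (`exists_monomial_bounds`). -/

/-! ### A loop language and its compilation -/

namespace VCKernel

/-- Expressions of a small loop language. They are evaluated in a `RamState`, whose registers are
the variables, and relative to a fixed number, the *size*. -/
inductive Expr where
  /-- a numeral -/
  | lit (a : ℕ) : Expr
  /-- the size -/
  | size : Expr
  /-- the value of a variable -/
  | var (v : ℕ) : Expr
  /-- addition -/
  | add (e f : Expr) : Expr
  /-- truncated subtraction -/
  | sub (e f : Expr) : Expr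
  /-- the size times an expression -/
  | mulSize (e : Expr) : Expr
  /-- the memory cell with the given address -/
  | mem (e : Expr) : Expr

/-- The value of an expression for the size `n`. -/
@[simp] def Expr.eval (n : ℕ) (σ : RamState) : Expr → ℕ
  | lit a => a
  | size => n
  | var v => σ.reg v
  | add e f => e.eval n σ + f.eval n σ
  | sub e f => e.eval n σ - f.eval n σ
  | mulSize e => n * e.eval n σ
  | mem e => σ.mem (e.eval n σ)

/-- Commands of the loop language. Since all loops run over `0, …, n - 1`, where `n` is the size,
the running time of a command is at most a polynomial in `n` that can be read off its syntax. -/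
inductive Cmd where
  /-- do nothing -/
  | skip : Cmd
  /-- assign the value of `e` to the variable `v` -/
  | assign (v : ℕ) (e : Expr) : Cmd
  /-- write the value of `f` into the memory cell with address `e` -/
  | store (e f : Expr) : Cmd
  /-- sequential composition -/
  | seq (C D : Cmd) : Cmd
  /-- run `C` if `e` is not zero and `D` otherwise -/
  | ite (e : Expr) (C D : Cmd) : Cmd
  /-- run `C` for `v = 0, …, n - 1`; assignments to `v` in `C` do not affect the iteration -/
  | forAll (v : ℕ) (C : Cmd) : Cmd

/-- The state after running a command for the size `n`. -/
def Cmd.run (n : ℕ) : Cmd → RamState → RamState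
  | skip, σ => σ
  | assign v e, σ => σ.setReg v (e.eval n σ)
  | store e f, σ => σ.setMem (e.eval n σ) (f.eval n σ)
  | seq C D, σ => D.run n (C.run n σ)
  | ite e C D, σ => if e.eval n σ ≠ 0 then C.run n σ else D.run n σ
  | forAll v C, σ => (List.range n).foldl (fun σ i => C.run n (σ.setReg v i)) σ

section

variable (n : ℕ) (σ : RamState)

@[simp] theorem Cmd.run_skip : skip.run n σ = σ := rfl

@[simp] theorem Cmd.run_assign (v : ℕ) (e : Expr) :
    (assign v e).run n σ = σ.setReg v (e.eval n σ) := rfl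

@[simp] theorem Cmd.run_store (e f : Expr) :
    (store e f).run n σ = σ.setMem (e.eval n σ) (f.eval n σ) := rfl

@[simp] theorem Cmd.run_seq (C D : Cmd) : (seq C D).run n σ = D.run n (C.run n σ) := rfl

@[simp] theorem Cmd.run_ite (e : Expr) (C D : Cmd) :
    (ite e C D).run n σ = if e.eval n σ ≠ 0 then C.run n σ else D.run n σ := rfl

end

@[simp] theorem RamState.setReg_reg (s : RamState) (r a r' : ℕ) :
    (s.setReg r a).reg r' = if r' = r then a else s.reg r' := by
  simp [RamState.setReg, Function.update_apply]

@[simp] theorem RamState.setReg_mem (s : RamState) (r a : ℕ) : (s.setReg r a).mem = s.mem := rfl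

@[simp] theorem RamState.setMem_reg (s : RamState) (i a : ℕ) : (s.setMem i a).reg = s.reg := rfl

theorem RamState.setMem_mem (s : RamState) (i a : ℕ) :
    (s.setMem i a).mem = Function.update s.mem i a := rfl

/-- The machine state `s` represents the state `σ` of the loop language for the size `n`. The
registers `3 * v` hold the variables, the registers `3 * d + 1` are temporary, the register `2`
holds the size, and the registers `3 * k + 2` with `1 ≤ k` are loop counters. -/
structure Represents (n : ℕ) (s σ : RamState) : Prop where
  size : s.reg 2 = n
  var : ∀ v, s.reg (3 * v) = σ.reg v
  mem : s.mem = σ.mem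

/-- Code that puts the value of an expression into the temporary register `3 * d + 1` and changes
no other registers than temporary ones from there on. -/
def Expr.compile : Expr → ℕ → RamProg
  | lit a, d => .const (3 * d + 1) a
  | size, d => .seq (.const (3 * d + 1) 0) (.add (3 * d + 1) (3 * d + 1) 2)
  | var v, d => .seq (.const (3 * d + 1) 0) (.add (3 * d + 1) (3 * d + 1) (3 * v))
  | add e f, d => .seq (e.compile d) (.seq (f.compile (d + 1))
      (.add (3 * d + 1) (3 * d + 1) (3 * (d + 1) + 1)))
  | sub e f, d => .seq (e.compile d) (.seq (f.compile (d + 1))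
      (.sub (3 * d + 1) (3 * d + 1) (3 * (d + 1) + 1)))
  | mulSize e, d => .seq (e.compile (d + 1)) (.seq (.const (3 * d + 1) 0)
      (.seq (.const (3 * (d + 3) + 1) 1) (.seq (.const (3 * (d + 2) + 1) 0)
      (.seq (.add (3 * (d + 2) + 1) (3 * (d + 2) + 1) 2)
      (.loop (3 * (d + 2) + 1)
        (.seq (.add (3 * d + 1) (3 * d + 1) (3 * (d + 1) + 1))
          (.sub (3 * (d + 2) + 1) (3 * (d + 2) + 1) (3 * (d + 3) + 1))))))))
  | mem e, d => .seq (e.compile d) (.load (3 * d + 1) (3 * d + 1))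

/-- Repeated addition: the loop in the code for `Expr.mulSize`. -/
theorem ramExec_mulLoop (d m : ℕ) : ∀ (s : RamState), s.reg (3 * (d + 2) + 1) = m →
    s.reg (3 * (d + 3) + 1) = 1 →
    ∃ s', RamExec (.loop (3 * (d + 2) + 1)
        (.seq (.add (3 * d + 1) (3 * d + 1) (3 * (d + 1) + 1))
          (.sub (3 * (d + 2) + 1) (3 * (d + 2) + 1) (3 * (d + 3) + 1)))) s s' (3 * m + 1) ∧
      s'.reg (3 * d + 1) = s.reg (3 * d + 1) + m * s.reg (3 * (d + 1) + 1) ∧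
      (∀ r, (∀ j, d ≤ j → r ≠ 3 * j + 1) → s'.reg r = s.reg r) ∧ s'.mem = s.mem := by
  induction m with
  | zero =>
    intro s hs h1
    exact ⟨s, .loop_done hs, by simp, fun _ _ => rfl, rfl⟩
  | succ m ih =>
    intro s hs h1
    obtain ⟨s', he, hv, hr, hm⟩ := ih
      ((s.setReg (3 * d + 1) (s.reg (3 * d + 1) + s.reg (3 * (d + 1) + 1))).setReg
        (3 * (d + 2) + 1) m) (by simp) (by simp [h1])
    refine ⟨s', ?_, ?_, fun r h => ?_, by simp [hm]⟩
    · have h2 : 3 * (m + 1) + 1 = (1 + 1) + (3 * m + 1) + 1 := by ring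
      rw [h2]
      refine .loop_step (by omega) (.seq (.add _ _ _ _) ?_) he
      convert RamExec.sub _ _ _ _ using 2
      simp [hs, h1]
    · rw [hv]
      simp
      ring
    · have := h d le_rfl
      have := h (d + 2) (by omega)
      rw [hr r h]
      simp [*]

/-- The compilation of expressions is correct, and the running time is polynomial in the size. -/
theorem Expr.exists_ramExec (e : Expr) : ∃ q : Polynomial ℕ, ∀ (n d : ℕ) (s σ : RamState),
    Represents n s σ → ∃ s' t, RamExec (e.compile d) s s' t ∧ t ≤ q.eval n ∧
      s'.reg (3 * d + 1) = e.eval n σ ∧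
      (∀ r, (∀ j, d ≤ j → r ≠ 3 * j + 1) → s'.reg r = s.reg r) ∧ s'.mem = s.mem := by
  have hrep : ∀ {n d : ℕ} {s s' σ : RamState}, Represents n s σ →
      (∀ r, (∀ j, d ≤ j → r ≠ 3 * j + 1) → s'.reg r = s.reg r) → s'.mem = s.mem →
      Represents n s' σ := fun h hr hm =>
    ⟨by rw [hr _ (by omega), h.size], fun v => by rw [hr _ (by omega), h.var], by rw [hm, h.mem]⟩
  have hself : ∀ {d r : ℕ} , (∀ j, d ≤ j → r ≠ 3 * j + 1) → r ≠ 3 * d + 1 := fun h => h _ le_rfl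
  induction e with
  | lit a =>
    refine ⟨1, fun n d s σ h => ⟨_, _, .const _ _ _, by simp, by simp [eval], fun r hr => ?_, rfl⟩⟩
    simp [hself hr]
  | size =>
    refine ⟨2, fun n d s σ h => ⟨_, _, .seq (.const _ _ _) (.add _ _ _ _), by simp,
      ?_, fun r hr => ?_, rfl⟩⟩
    · have : 2 ≠ 3 * d + 1 := by omega
      simp [eval, h.size, this]
    · simp [hself hr]
  | var v =>
    refine ⟨2, fun n d s σ h => ⟨_, _, .seq (.const _ _ _) (.add _ _ _ _), by simp,
      ?_, fun r hr => ?_, rfl⟩⟩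
    · have : 3 * v ≠ 3 * d + 1 := by omega
      simp [eval, h.var, this]
    · simp [hself hr]
  | add e f ihe ihf =>
    obtain ⟨q₁, h₁⟩ := ihe
    obtain ⟨q₂, h₂⟩ := ihf
    refine ⟨q₁ + (q₂ + 1), fun n d s σ h => ?_⟩
    obtain ⟨s₁, t₁, he₁, ht₁, hv₁, hr₁, hm₁⟩ := h₁ n d s σ h
    obtain ⟨s₂, t₂, he₂, ht₂, hv₂, hr₂, hm₂⟩ := h₂ n (d + 1) s₁ σ (hrep h hr₁ hm₁)
    refine ⟨_, _, .seq he₁ (.seq he₂ (.add _ _ _ _)), by simp; omega, ?_, fun r hr => ?_,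
      by simp [hm₁, hm₂]⟩
    · rw [RamState.setReg_reg, if_pos rfl, hv₂, hr₂ _ (by omega), hv₁, eval]
    · rw [RamState.setReg_reg, if_neg (hself hr), hr₂ r fun j hj => hr j (by omega), hr₁ r hr]
  | sub e f ihe ihf =>
    obtain ⟨q₁, h₁⟩ := ihe
    obtain ⟨q₂, h₂⟩ := ihf
    refine ⟨q₁ + (q₂ + 1), fun n d s σ h => ?_⟩
    obtain ⟨s₁, t₁, he₁, ht₁, hv₁, hr₁, hm₁⟩ := h₁ n d s σ h
    obtain ⟨s₂, t₂, he₂, ht₂, hv₂, hr₂, hm₂⟩ := h₂ n (d + 1) s₁ σ (hrep h hr₁ hm₁)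
    refine ⟨_, _, .seq he₁ (.seq he₂ (.sub _ _ _ _)), by simp; omega, ?_, fun r hr => ?_,
      by simp [hm₁, hm₂]⟩
    · rw [RamState.setReg_reg, if_pos rfl, hv₂, hr₂ _ (by omega), hv₁, eval]
    · rw [RamState.setReg_reg, if_neg (hself hr), hr₂ r fun j hj => hr j (by omega), hr₁ r hr]
  | mulSize e ih =>
    obtain ⟨q, hq⟩ := ih
    refine ⟨q + 3 * Polynomial.X + 5, fun n d s σ h => ?_⟩
    obtain ⟨s₁, t₁, he₁, ht₁, hv₁, hr₁, hm₁⟩ := hq n (d + 1) s σ h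
    have h2 : s₁.reg 2 = n := (hrep h hr₁ hm₁).size
    have h2d : ∀ j, 2 ≠ 3 * j + 1 := by omega
    obtain ⟨s₂, he₂, hv₂, hr₂, hm₂⟩ := ramExec_mulLoop d n
      ((((s₁.setReg (3 * d + 1) 0).setReg (3 * (d + 3) + 1) 1).setReg (3 * (d + 2) + 1) 0).setReg
        (3 * (d + 2) + 1) n) (by simp) (by simp)
    refine ⟨s₂, _, .seq he₁ (.seq (.const _ _ _) (.seq (.const _ _ _) (.seq (.const _ _ _)
      (.seq (t' := 3 * n + 1) (t := 1) ?_ he₂)))), by simp; omega, ?_, fun r hr => ?_,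
      by simp [hm₁, hm₂]⟩
    · convert RamExec.add _ _ _ _ using 2
      have := h2d (d + 2)
      have := h2d (d + 3)
      have := h2d d
      simp [*, h.size]
    · rw [hv₂]
      simp [hv₁, eval]
    · rw [hr₂ r hr]
      have := hr d le_rfl
      have := hr (d + 2) (by omega)
      have := hr (d + 3) (by omega)
      simp [*, hr₁ r fun j hj => hr j (by omega)]
  | mem e ih =>
    obtain ⟨q, hq⟩ := ih
    refine ⟨q + 1, fun n d s σ h => ?_⟩
    obtain ⟨s₁, t₁, he₁, ht₁, hv₁, hr₁, hm₁⟩ := hq n d s σ h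
    refine ⟨_, _, .seq he₁ (.load _ _ _), by simpa using ht₁, ?_, fun r hr => ?_, by simp [hm₁]⟩
    · simp [hv₁, hm₁, h.mem, eval]
    · simp [hself hr, hr₁ r hr]

/-- Code for a command that uses only the loop counters from number `k` on. -/
def Cmd.compile : Cmd → ℕ → RamProg
  | skip, _ => .skip
  | assign v e, _ => .seq (e.compile 0) (.seq (.const (3 * v) 0) (.add (3 * v) (3 * v) 1))
  | store e f, _ => .seq (e.compile 0) (.seq (f.compile 1) (.store 1 4))
  | seq C D, k => .seq (C.compile k) (D.compile k)
  | ite e C D, k => .seq (e.compile 0) (.branch 1 (C.compile k) (D.compile k))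
  | forAll v C, k => .seq (.const (3 * k + 2) 0) (.seq (.add (3 * k + 2) (3 * k + 2) 2)
      (.loop (3 * k + 2) (.seq (.sub (3 * v) 2 (3 * k + 2)) (.seq (C.compile (k + 1))
        (.seq (.const 1 1) (.sub (3 * k + 2) (3 * k + 2) 1))))))

/-- The compilation of commands is correct, and the running time is polynomial in the size. -/
theorem Cmd.exists_ramExec (C : Cmd) : ∃ q : Polynomial ℕ, ∀ (n k : ℕ) (s σ : RamState),
    1 ≤ k → Represents n s σ → ∃ s' t, RamExec (C.compile k) s s' t ∧ t ≤ q.eval n ∧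
      Represents n s' (C.run n σ) ∧ ∀ j < k, s'.reg (3 * j + 2) = s.reg (3 * j + 2) := by
  have hrep : ∀ {n d : ℕ} {s s' σ : RamState}, Represents n s σ →
      (∀ r, (∀ j, d ≤ j → r ≠ 3 * j + 1) → s'.reg r = s.reg r) → s'.mem = s.mem →
      Represents n s' σ := fun h hr hm =>
    ⟨by rw [hr _ (by omega), h.size], fun v => by rw [hr _ (by omega), h.var], by rw [hm, h.mem]⟩
  induction C with
  | skip => exact ⟨1, fun n k s σ _ h => ⟨s, 1, .skip s, by simp, h, fun _ _ => rfl⟩⟩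
  | assign v e =>
    obtain ⟨q, hq⟩ := e.exists_ramExec
    refine ⟨q + 2, fun n k s σ _ h => ?_⟩
    obtain ⟨s₁, t₁, he₁, ht₁, hv₁, hr₁, hm₁⟩ := hq n 0 s σ h
    have h₁ := hrep h hr₁ hm₁
    have h1 : 1 ≠ 3 * v := by omega
    have h2 : 2 ≠ 3 * v := by omega
    refine ⟨_, _, .seq he₁ (.seq (.const _ _ _) (.add _ _ _ _)), by simpa using ht₁,
      ⟨?_, fun w => ?_, ?_⟩, fun j _ => ?_⟩
    · simp [h2, h₁.size]
    · by_cases hw : w = v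
      · simpa [hw, run, h1] using hv₁
      · simp [hw, run, h₁.var]
    · simp [run, h₁.mem]
    · have : 3 * j + 2 ≠ 3 * v := by omega
      simp [this, hr₁ (3 * j + 2) (by omega)]
  | store e f =>
    obtain ⟨q₁, hq₁⟩ := e.exists_ramExec
    obtain ⟨q₂, hq₂⟩ := f.exists_ramExec
    refine ⟨q₁ + (q₂ + 1), fun n k s σ _ h => ?_⟩
    obtain ⟨s₁, t₁, he₁, ht₁, hv₁, hr₁, hm₁⟩ := hq₁ n 0 s σ h
    obtain ⟨s₂, t₂, he₂, ht₂, hv₂, hr₂, hm₂⟩ := hq₂ n 1 s₁ σ (hrep h hr₁ hm₁)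
    have h₂ := hrep (hrep h hr₁ hm₁) hr₂ hm₂
    refine ⟨_, _, .seq he₁ (.seq he₂ (.store _ _ _)), by simp; omega,
      ⟨h₂.size, h₂.var, ?_⟩, fun j _ => ?_⟩
    · rw [show 3 * 0 + 1 = 1 from rfl] at hv₁
      rw [show 3 * 1 + 1 = 4 from rfl] at hv₂
      simp only [run, RamState.setMem_mem, h₂.mem, hv₂, hr₂ 1 (by omega), hv₁]
    · simp [hr₂ (3 * j + 2) (by omega), hr₁ (3 * j + 2) (by omega)]
  | seq C D ihC ihD =>
    obtain ⟨q₁, hq₁⟩ := ihC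
    obtain ⟨q₂, hq₂⟩ := ihD
    refine ⟨q₁ + q₂, fun n k s σ hk h => ?_⟩
    obtain ⟨s₁, t₁, he₁, ht₁, h₁, hr₁⟩ := hq₁ n k s σ hk h
    obtain ⟨s₂, t₂, he₂, ht₂, h₂, hr₂⟩ := hq₂ n k s₁ _ hk h₁
    exact ⟨_, _, .seq he₁ he₂, by simp; omega, h₂, fun j hj => by rw [hr₂ j hj, hr₁ j hj]⟩
  | ite e C D ihC ihD =>
    obtain ⟨q, hq⟩ := e.exists_ramExec
    obtain ⟨q₁, hq₁⟩ := ihC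
    obtain ⟨q₂, hq₂⟩ := ihD
    refine ⟨q + (q₁ + q₂ + 1), fun n k s σ hk h => ?_⟩
    obtain ⟨s', t', he', ht', hv', hr', hm'⟩ := hq n 0 s σ h
    have h' := hrep h hr' hm'
    have hj' : ∀ j, s'.reg (3 * j + 2) = s.reg (3 * j + 2) := fun j => hr' _ (by omega)
    rw [show 3 * 0 + 1 = 1 from rfl] at hv'
    by_cases h0 : e.eval n σ = 0
    · obtain ⟨s₂, t₂, he₂, ht₂, h₂, hr₂⟩ := hq₂ n k s' σ hk h'
      refine ⟨_, _, .seq he' (.branch_false (by rw [hv', h0]) he₂), by simp; omega, ?_,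
        fun j hj => by rw [hr₂ j hj, hj']⟩
      simpa [run, h0] using h₂
    · obtain ⟨s₁, t₁, he₁, ht₁, h₁, hr₁⟩ := hq₁ n k s' σ hk h'
      refine ⟨_, _, .seq he' (.branch_true (by rwa [hv']) he₁), by simp; omega, ?_,
        fun j hj => by rw [hr₁ j hj, hj']⟩
      simpa [run, h0] using h₁
  | forAll v C ih =>
    obtain ⟨q, hq⟩ := ih
    refine ⟨Polynomial.X * (q + 4) + 3, fun n k s σ hk h => ?_⟩
    -- the last `m` iterations
    have key : ∀ (m : ℕ) (s σ : RamState), m ≤ n → Represents n s σ → s.reg (3 * k + 2) = m →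
        ∃ s' t, RamExec (.loop (3 * k + 2) (.seq (.sub (3 * v) 2 (3 * k + 2))
          (.seq (C.compile (k + 1))
            (.seq (.const 1 1) (.sub (3 * k + 2) (3 * k + 2) 1))))) s s' t ∧
          t ≤ m * (q.eval n + 4) + 1 ∧
          Represents n s' ((List.range' (n - m) m).foldl
            (fun σ i => C.run n (σ.setReg v i)) σ) ∧
          ∀ j < k, s'.reg (3 * j + 2) = s.reg (3 * j + 2) := by
      intro m
      induction m with
      | zero =>
        intro s σ _ h hs
        exact ⟨s, 1, .loop_done hs, by simp, by simpa using h, fun _ _ => rfl⟩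
      | succ m ihm =>
        intro s σ hm h hs
        obtain ⟨s₁, t₁, he₁, ht₁, h₁, hr₁⟩ := hq n (k + 1) (s.setReg (3 * v) (n - (m + 1)))
          (σ.setReg v (n - (m + 1))) (by omega) (by
            refine ⟨?_, fun w => ?_, by simp [h.mem]⟩
            · have : 2 ≠ 3 * v := by omega
              simp [this, h.size]
            · simp [h.var])
        have hk₁ : s₁.reg (3 * k + 2) = m + 1 := by
          have : 3 * k + 2 ≠ 3 * v := by omega
          simp [hr₁ k (by omega), this, hs]
        obtain ⟨s₂, t₂, he₂, ht₂, h₂, hr₂⟩ := ihm ((s₁.setReg 1 1).setReg (3 * k + 2) m)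
          (C.run n (σ.setReg v (n - (m + 1)))) (by omega) (by
            refine ⟨?_, fun w => ?_, ?_⟩
            · have : k ≠ 0 := by omega
              simp [this, h₁.size]
            · have : 3 * w ≠ 3 * k + 2 := by omega
              have : 3 * w ≠ 1 := by omega
              rw [RamState.setReg_reg, if_neg ‹_›, RamState.setReg_reg, if_neg ‹_›, h₁.var]
            · exact h₁.mem) (by simp)
        refine ⟨s₂, _, .loop_step (by omega) (.seq (t := 1) ?_ (.seq he₁
          (.seq (.const _ _ _) (t' := 1) ?_))) he₂, ?_, ?_, fun j hj => ?_⟩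
        · convert RamExec.sub _ _ _ _ using 2
          rw [h.size, hs]
        · convert RamExec.sub _ _ _ _ using 2
          simp [hk₁]
        · rw [Nat.succ_mul]
          omega
        · rw [List.range'_succ, List.foldl_cons]
          convert h₂ using 3
          omega
        · rw [hr₂ j hj]
          have h4 : 3 * j + 2 ≠ 3 * v := by omega
          have h5 : j ≠ k := by omega
          simp [hr₁ j (by omega), h4, h5]
    obtain ⟨s', t, he, ht, hs', hr⟩ := key n (s.setReg (3 * k + 2) n) σ le_rfl (by
      refine ⟨?_, fun w => ?_, h.mem⟩
      · have : k ≠ 0 := by omega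
        simp [this, h.size]
      · have : 3 * w ≠ 3 * k + 2 := by omega
        simp [this, h.var]) (by simp)
    refine ⟨s', _, .seq (.const _ _ _) (.seq (t := 1) ?_ he), ?_, ?_, fun j hj => ?_⟩
    · convert RamExec.add _ _ _ _ using 1
      have : 2 ≠ 3 * k + 2 := by omega
      rw [RamState.setReg_reg, if_pos rfl, RamState.setReg_reg, if_neg this, h.size]
      simp [RamState.setReg]
    · simp
      omega
    · simpa [run, List.range_eq_range'] using hs'
    · rw [hr j hj]
      have h5 : j ≠ k := by omega
      simp [h5]

/-- A function computed by a command whose size is the first word of the input is computable in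
polynomial time. The prologue of the machine program loads this word into the size register. -/
theorem polyTimeComputable_of_cmd {α β : Type} {encα : α → List ℕ} {encβ : β → List ℕ}
    {f : α → β} (C : Cmd) (size : α → ℕ) (hsize : ∀ a, (encα a).head? = some (size a))
    (hlen : ∀ a, size a ≤ bitLength (encα a))
    (hC : ∀ a, RamOutputs (C.run (size a) (ramInput (encα a))) (encβ (f a))) :
    PolyTimeComputable encα encβ f := by
  obtain ⟨q, hq⟩ := C.exists_ramExec
  refine ⟨.seq (.load 2 2) (C.compile 1), q + 1, fun a => ?_⟩
  obtain ⟨s, t, he, ht, hs, -⟩ := hq (size a) 1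
    ((ramInput (encα a)).setReg 2 (size a)) (ramInput (encα a)) le_rfl
    ⟨by simp, fun v => by
      have : 3 * v ≠ 2 := by omega
      simp [this, ramInput], rfl⟩
  refine ⟨s, 1 + t, .seq ?_ he, ?_, ?_⟩
  · convert RamExec.load _ _ _ using 2
    have := hsize a
    rcases h : encα a with _ | ⟨b, w⟩
    · simp [h] at this
    · simpa [ramInput, h, eq_comm] using this
  · have : q.eval (size a) ≤ q.eval (bitLength (encα a)) := by
      simp only [Polynomial.eval_eq_sum, Polynomial.sum]
      gcongr
      exact hlen a
    simp
    omega
  · obtain ⟨h0, hm⟩ := hC a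
    refine ⟨?_, fun i hi => ?_⟩
    · rw [← h0, ← hs.var]
    · rw [← hm i hi, hs.mem]

end VCKernel

/-! ### The graph-theoretic core of the kernelization -/

namespace VCKernel

/-- The rank function maps a finite set `T` bijectively to `0, …, #T - 1`. -/
theorem card_filter_rank_lt {V : Type*} [LinearOrder V] (T : Finset V) (l : ℕ) :
    (T.filter fun v => (T.filter (· < v)).card < l).card = min l T.card := by
  have hlt : ∀ {u v : V}, u ∈ T → u < v → (T.filter (· < u)).card < (T.filter (· < v)).card := by
    intro u v hu huv
    refine Finset.card_lt_card ⟨fun w hw => ?_, fun h => ?_⟩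
    · simp only [Finset.mem_filter] at hw ⊢
      exact ⟨hw.1, hw.2.trans huv⟩
    · simpa using h (Finset.mem_filter.2 ⟨hu, huv⟩)
  have hinj : Set.InjOn (fun v => (T.filter (· < v)).card) T := by
    intro u hu v hv h
    rcases lt_trichotomy u v with h' | h' | h'
    · exact absurd h (hlt hu h').ne
    · exact h'
    · exact absurd h (hlt hv h').ne'
  have himage : T.image (fun v => (T.filter (· < v)).card) = Finset.range T.card := by
    refine Finset.eq_of_subset_of_card_le (fun a ha => ?_) ?_
    · obtain ⟨v, hv, rfl⟩ := Finset.mem_image.1 ha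
      refine Finset.mem_range.2 (Finset.card_lt_card (Finset.filter_ssubset.2 ⟨v, hv, by simp⟩))
    · rw [Finset.card_image_of_injOn hinj, Finset.card_range]
  rw [← Finset.card_image_of_injOn (hinj.mono (Finset.filter_subset _ _))]
  have h2 : (T.filter fun v => (T.filter (· < v)).card < l).image
      (fun v => (T.filter (· < v)).card) = Finset.range (min l T.card) := by
    have := Finset.filter_image (s := T) (f := fun v => (T.filter (· < v)).card) (p := (· < l))
    rw [← this, himage]
    ext a
    simp [and_comm]
  rw [h2, Finset.card_range]

/-- A set of at most `c` elements is contained in the range of a `c`-tuple. Tuples that are too long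
are filled up with repetitions of an element of `X`. -/
theorem exists_tuple_of_card_le {V : Type*} {X D : Finset V} {c : ℕ} (hX : X.Nonempty)
    (hDX : D ⊆ X) (hD : D.card ≤ c) :
    ∃ y : Fin c → V, (∀ i, y i ∈ X) ∧ ∀ w ∈ D, ∃ i, y i = w := by
  obtain ⟨x, hx⟩ := hX
  refine ⟨fun i => D.toList.getD i x, fun i => ?_, fun w hw => ?_⟩
  · beta_reduce
    rcases lt_or_ge (i : ℕ) D.toList.length with h | h
    · rw [List.getD_eq_getElem _ _ h]
      exact hDX (Finset.mem_toList.1 (List.getElem_mem h))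
    · rwa [List.getD_eq_default _ _ h]
  · obtain ⟨i, hi, rfl⟩ := List.getElem_of_mem (Finset.mem_toList.2 hw)
    exact ⟨⟨i, by rw [Finset.length_toList] at hi; omega⟩, List.getD_eq_getElem _ _ hi⟩

section Marking

variable {V : Type} [LinearOrder V] [Fintype V] (G : SimpleGraph V) (X : Finset V) {c : ℕ}

open Classical in
/-- The vertices outside `X` that have the same adjacencies as `v` to the vertices of the
tuple `y`. -/
noncomputable def twins (y : Fin c → V) (v : V) : Finset V :=
  Finset.univ.filter fun u => u ∉ X ∧ ∀ i, G.Adj (y i) u ↔ G.Adj (y i) v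

open Classical in
/-- A vertex is marked if it lies in `X` or is among the first `l` vertices outside `X` with its
adjacencies to some `c`-tuple of vertices of `X`. -/
def Marked (c l : ℕ) (v : V) : Prop :=
  v ∈ X ∨ ∃ y : Fin c → V, (∀ i, y i ∈ X) ∧ ((twins G X y v).filter (· < v)).card < l

variable {G X}

theorem mem_twins {y : Fin c → V} {u v : V} :
    u ∈ twins G X y v ↔ u ∉ X ∧ ∀ i, G.Adj (y i) u ↔ G.Adj (y i) v := by
  simp [twins]

theorem twins_eq_of_mem {y : Fin c → V} {u v : V} (h : u ∈ twins G X y v) :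
    twins G X y u = twins G X y v := by
  ext w
  simp only [mem_twins] at *
  simp only [h.2]

open Classical in
theorem card_marked_le {l : ℕ} :
    (Finset.univ.filter (Marked G X c l)).card ≤ X.card + 2 ^ c * X.card ^ c * l := by
  -- the marked vertices outside `X` are indexed by a tuple over `X` and a pattern of adjacencies
  let F : (Fin c → V) × (Fin c → Bool) → Finset V := fun yb =>
    let T := Finset.univ.filter fun u => u ∉ X ∧ ∀ i, G.Adj (yb.1 i) u ↔ yb.2 i = true
    T.filter fun v => (T.filter (· < v)).card < l
  have hF : ∀ yb, (F yb).card ≤ l := fun yb => by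
    simp only [F]
    rw [card_filter_rank_lt]
    exact min_le_left _ _
  have hsub : Finset.univ.filter (Marked G X c l) ⊆
      X ∪ ((Fintype.piFinset fun _ => X) ×ˢ Finset.univ).biUnion F := by
    intro v hv
    obtain hv | ⟨y, hy, hl⟩ := (Finset.mem_filter.1 hv).2
    · exact Finset.mem_union_left _ hv
    by_cases hvX : v ∈ X
    · exact Finset.mem_union_left _ hvX
    refine Finset.mem_union_right _ (Finset.mem_biUnion.2
      ⟨(y, fun i => decide (G.Adj (y i) v)), by simpa using hy, ?_⟩)
    simp only [F, Finset.mem_filter, decide_eq_true_eq, Finset.mem_univ, true_and, implies_true,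
      and_true]
    exact ⟨hvX, hl⟩
  refine (Finset.card_le_card hsub).trans ((Finset.card_union_le _ _).trans ?_)
  refine Nat.add_le_add_left (Finset.card_biUnion_le.trans
    ((Finset.sum_le_card_nsmul _ _ _ fun yb _ => hF yb).trans ?_)) _
  simp [mul_comm (2 ^ c)]

/-- An unmarked vertex `v` of a small set `P` can be exchanged: the twins of `v` are so many that
one of the marked ones avoids `P` and the small set `S`. -/
theorem exists_marked_twin {l : ℕ} {v : V} (hv : ¬ Marked G X c l v) {P S : Finset V}
    (hvP : v ∈ P) (hl : S.card + P.card ≤ l) {y : Fin c → V} (hy : ∀ i, y i ∈ X) :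
    ∃ u ∈ twins G X y v, Marked G X c l u ∧ u ∉ P ∧ u ∉ S := by
  simp only [Marked, not_or, not_exists, not_and, not_lt] at hv
  have hT : l ≤ (twins G X y v).card := (hv.2 y hy).trans (Finset.card_filter_le _ _)
  have hF : ((twins G X y v).filter fun u => ((twins G X y v).filter (· < u)).card < l).card = l :=
    (card_filter_rank_lt _ _).trans (min_eq_left hT)
  have hlt : (S ∪ P.erase v).card <
      ((twins G X y v).filter fun u => ((twins G X y v).filter (· < u)).card < l).card := by
    rw [hF]
    refine (Finset.card_union_le _ _).trans_lt ?_
    have := Finset.card_erase_lt_of_mem hvP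
    omega
  obtain ⟨u, hu, hu'⟩ := Finset.exists_mem_notMem_of_card_lt_card hlt
  rw [Finset.mem_filter] at hu
  simp only [Finset.mem_union, Finset.mem_erase, not_or, not_and] at hu'
  have hum : Marked G X c l u := .inr ⟨y, hy, by simpa only [twins_eq_of_mem hu.1] using hu.2⟩
  refine ⟨u, hu.1, hum, hu'.2 ?_, hu'.1⟩
  rintro rfl
  exact absurd hu.2 (not_lt.2 (hv.2 y hy))

end Marking

namespace GraphProperty

variable (Pr : GraphProperty)

/-- A copy of an induced subgraph is free of the property if and only if no set of vertices of this
subgraph induces a graph with the property. -/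
theorem inducedFree_comap_iff {V W : Type} [Finite V] [Finite W] (G : SimpleGraph V) (f : W ↪ V) :
    Pr.InducedFree (G.comap f) ↔
      ∀ P : Finset V, (P : Set V) ⊆ Set.range f → ¬ Pr.Holds (G.induce (P : Set V)) := by
  constructor
  · intro h P hP hH
    refine h _ _ hH ⟨⟨⟨fun w => (hP w.2).choose, fun a b hab => ?_⟩, fun {a b} => ?_⟩⟩
    · rw [Subtype.ext_iff, ← (hP a.2).choose_spec, ← (hP b.2).choose_spec]
      exact congrArg f hab
    · simp [(hP a.2).choose_spec, (hP b.2).choose_spec]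
  · rintro h U _ H hH ⟨e⟩
    have : Fintype U := Fintype.ofFinite U
    classical
    refine h (Finset.univ.image (f ∘ e))
      (by simpa [Function.comp_def] using Set.range_comp_subset_range e f) ?_
    refine (Pr.iso_iff ⟨⟨(Equiv.ofInjective _ (f.injective.comp e.injective)).trans
      (Equiv.setCongr (by simp [Function.comp_def])), fun {a b} => ?_⟩⟩).1 hH
    exact e.map_adj_iff

variable {Pr}

/-- If `u` and `v` have the same adjacencies to the vertices of `D`, where `D` is a set of
vertices that determines the property at `v`, then `v` can be exchanged for `u`. -/
theorem holds_induce_exchange {V : Type} [DecidableEq V] [Finite V] {G : SimpleGraph V}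
    {P : Finset V} {v : P} {u : V} (hu : u ∉ P) {D : Finset P} (hvD : v ∉ D)
    (hD : ∀ G' : SimpleGraph P,
      (∀ a b, a ≠ v → b ≠ v → (G'.Adj a b ↔ (G.induce (P : Set V)).Adj a b)) →
      (∀ a ∈ D, (G'.Adj v a ↔ (G.induce (P : Set V)).Adj v a)) → Pr.Holds G')
    (huv : ∀ a ∈ D, (G.Adj u a ↔ G.Adj v a)) :
    Pr.Holds (G.induce ((insert u (P.erase v) : Finset V) : Set V)) := by
  set f : P → V := fun a => if a = v then u else a with hf
  have hfinj : f.Injective := by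
    intro a b hab
    simp only [hf] at hab
    split_ifs at hab with ha hb hb
    · rw [ha, hb]
    · exact absurd (hab ▸ b.2) hu
    · exact absurd (hab ▸ a.2) hu
    · exact Subtype.ext hab
  have hrange : Set.range f = ((insert u (P.erase v) : Finset V) : Set V) := by
    ext w
    simp only [hf, Set.mem_range, Finset.coe_insert, Finset.coe_erase, Set.mem_insert_iff,
      Set.mem_sdiff, Finset.mem_coe, Set.mem_singleton_iff]
    constructor
    · rintro ⟨a, rfl⟩
      split_ifs with ha
      · exact .inl rfl
      · exact .inr ⟨a.2, fun h => ha (Subtype.ext h)⟩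
    · rintro (rfl | ⟨hw, hwv⟩)
      · exact ⟨v, if_pos rfl⟩
      · exact ⟨⟨w, hw⟩, if_neg fun h => hwv (congrArg Subtype.val h)⟩
  refine (Pr.iso_iff (G := G.comap f) ⟨⟨(Equiv.ofInjective f hfinj).trans
    (Equiv.setCongr hrange), fun {a b} => Iff.rfl⟩⟩).1 (hD _ (fun a b ha hb => ?_) fun a ha => ?_)
  · simp [hf, ha, hb]
  · have hav : a ≠ v := fun h => hvD (h ▸ ha)
    simpa [hf, hav] using huv a ha

/-- A vertex-minimal induced subgraph is small, since its vertex cover number is at most the size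
of a vertex cover of the whole graph. -/
theorem VertexMinimal.card_le {p : ℕ → ℕ} (hmono : Monotone p)
    (hvc : ∀ (V : Type) [Finite V] (G : SimpleGraph V), Pr.VertexMinimal G →
      Nat.card V ≤ p G.vertexCoverNum.toNat)
    {V : Type} [Finite V] {G : SimpleGraph V} {X : Finset V} (hX : G.IsVertexCover (X : Set V))
    {P : Finset V} (hP : Pr.VertexMinimal (G.induce (P : Set V))) : P.card ≤ p X.card := by
  have h1 := hvc _ _ hP
  have h2 : (G.induce (P : Set V)).IsVertexCover (Subtype.val ⁻¹' (X : Set V)) :=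
    fun a b hab => hX hab
  have h3 : (G.induce (P : Set V)).vertexCoverNum ≤ (X.card : ℕ∞) := by
    refine h2.vertexCoverNum_le.trans ?_
    rw [← Set.encard_coe_eq_coe_finsetCard, ← Subtype.val_injective.encard_image]
    exact Set.encard_le_encard (Set.image_preimage_subset _ _)
  have h4 := hmono (ENat.toNat_le_of_le_natCast h3)
  simp only [SetLike.coe_sort_coe, Nat.card_eq_fintype_card, Fintype.card_coe] at h1
  omega

/-- The safeness of the marking: a set of at most `k` vertices that hits all occurrences of the
property among the marked vertices hits all occurrences. An occurrence `P` that is not hit is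
either not vertex-minimal, or has an unmarked vertex that can be exchanged for a marked one. -/
theorem not_holds_of_marked {c : ℕ} {p : ℕ → ℕ} (hadj : Pr.CharacterizedByAdjacencies c)
    (hmono : Monotone p)
    (hvc : ∀ (V : Type) [Finite V] (G : SimpleGraph V), Pr.VertexMinimal G →
      Nat.card V ≤ p G.vertexCoverNum.toNat)
    {V : Type} [LinearOrder V] [Fintype V] {G : SimpleGraph V} {X : Finset V}
    (hX : G.IsVertexCover (X : Set V)) (hne : X.Nonempty) {S : Finset V} {l : ℕ}
    (hl : S.card + p X.card ≤ l)
    (hS : ∀ P : Finset V, (∀ v ∈ P, Marked G X c l v) → Disjoint P S →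
      ¬ Pr.Holds (G.induce (P : Set V))) (P : Finset V) (hPS : Disjoint P S) :
    ¬ Pr.Holds (G.induce (P : Set V)) := by
  classical
  induction P using WellFounded.induction
    (InvImage.wf (fun P : Finset V => toLex (P.card, (P.filter fun v => ¬ Marked G X c l v).card))
      wellFounded_lt) with
  | _ P ih =>
  intro hH
  simp only [InvImage, Prod.Lex.toLex_lt_toLex] at ih
  by_cases hmin : Pr.VertexMinimal (G.induce (P : Set V))
  · have hcard := hmin.card_le hmono hvc hX
    by_cases hm : ∀ v ∈ P, Marked G X c l v
    · exact hS P hm hPS hH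
    push Not at hm
    obtain ⟨v, hvP, hvm⟩ := hm
    obtain ⟨D, hvD, hDc, hD⟩ := hadj _ _ hH ⟨v, hvP⟩
    obtain ⟨y, hy, hyD⟩ := exists_tuple_of_card_le (X := X) (c := c)
      (D := (D.map (Function.Embedding.subtype _)).filter (· ∈ X)) hne
      (fun w hw => (Finset.mem_filter.1 hw).2)
      ((Finset.card_filter_le _ _).trans (by rwa [Finset.card_map]))
    obtain ⟨u, hut, hum, huP, huS⟩ := exists_marked_twin hvm (S := S) hvP (by omega) hy
    rw [mem_twins] at hut
    have hvX : v ∉ X := fun h => hvm (.inl h)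
    -- the exchange keeps the cardinality and reduces the number of unmarked vertices
    refine ih (insert u (P.erase v)) (.inr ⟨?_, ?_⟩) ?_
      (holds_induce_exchange (v := ⟨v, hvP⟩) huP hvD hD fun a ha => ?_)
    · rw [Finset.card_insert_of_notMem (fun h => huP (Finset.mem_of_mem_erase h)),
        Finset.card_erase_add_one hvP]
    · refine Finset.card_lt_card ⟨fun w hw => ?_, fun h => ?_⟩
      · simp only [Finset.mem_filter, Finset.mem_insert, Finset.mem_erase] at hw ⊢
        obtain ⟨rfl | hw, hwm⟩ := hw
        · exact absurd hum hwm
        · exact ⟨hw.2, hwm⟩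
      · have := h (Finset.mem_filter.2 ⟨hvP, hvm⟩)
        simp only [Finset.mem_filter, Finset.mem_insert, Finset.mem_erase] at this
        obtain ⟨rfl | h', -⟩ := this
        · exact huP hvP
        · exact h'.1 rfl
    · rw [Finset.disjoint_insert_left]
      exact ⟨huS, hPS.mono_left (Finset.erase_subset _ _)⟩
    · by_cases haX : (a : V) ∈ X
      · obtain ⟨i, hi⟩ := hyD a (by simp [haX, ha])
        rw [G.adj_comm u, G.adj_comm _ (a : V), ← hi]
        exact hut.2 i
      · -- outside the vertex cover there are no edges
        refine iff_of_false (fun h => ?_) fun h => ?_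
        · exact (hX h).elim hut.1 haX
        · exact (hX h).elim hvX haX
  · simp only [VertexMinimal, hH, true_and, not_forall, not_not] at hmin
    obtain ⟨Q, hQ, hQH⟩ := hmin
    have hlt : Q.toFinset.map (Function.Embedding.subtype _) ⊂ P := by
      refine ⟨fun a ha => ?_, fun h => hQ (Set.eq_univ_of_forall fun a => ?_)⟩
      · obtain ⟨b, -, rfl⟩ := Finset.mem_map.1 ha
        exact b.2
      · simpa using h a.2
    refine ih _ (.inl (Finset.card_lt_card hlt)) (hPS.mono_left hlt.1) ((Pr.iso_iff
      ⟨⟨(Equiv.Set.image _ Q Subtype.val_injective).trans (Equiv.setCongr ?_),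
        fun {a b} => Iff.rfl⟩⟩).1 hQH)
    ext w
    simp

end GraphProperty

end VCKernel

/-! ### The marking algorithm in the loop language -/

namespace VCKernel

/-- Loop invariants: `Inv i` holds before the iteration with number `i`. -/
theorem Cmd.run_forAll_induction {n : ℕ} {v : ℕ} {C : Cmd} {σ : RamState}
    (Inv : ℕ → RamState → Prop) (h0 : Inv 0 σ)
    (hstep : ∀ i < n, ∀ τ, Inv i τ → Inv (i + 1) (C.run n (τ.setReg v i))) :
    Inv n ((forAll v C).run n σ) := by
  have : ∀ m ≤ n, Inv m ((List.range m).foldl (fun σ i => C.run n (σ.setReg v i)) σ) := by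
    intro m
    induction m with
    | zero => exact fun _ => h0
    | succ m ih =>
      intro hm
      rw [List.range_succ, List.foldl_append]
      exact hstep m hm _ (ih (by omega))
  exact this n le_rfl

/-- The memory cell that tells whether a vertex belongs to the vertex cover. -/
def Expr.cover (e : Expr) : Expr := .mem (.add (.lit 2) e)

/-- The memory address of the entry of the adjacency matrix in row `e` and column `f`. -/
def Expr.entryAddr (e f : Expr) : Expr := .add (.add (.lit 2) .size) (.add (.mulSize e) f)

/-- The entry of the adjacency matrix in row `e` and column `f`. The free memory behind the matrix
acts as an additional row, whose number is the size; the algorithm keeps the marks there. -/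
def Expr.entry (e f : Expr) : Expr := .mem (e.entryAddr f)

/-- The address of an entry of the adjacency matrix of a graph with `n` vertices. -/
abbrev entryAddr (n i j : ℕ) : ℕ := 2 + n + (n * i + j)

@[simp] theorem Expr.eval_cover (n : ℕ) (σ : RamState) (e : Expr) :
    e.cover.eval n σ = σ.mem (2 + e.eval n σ) := rfl

@[simp] theorem Expr.eval_entryAddr (n : ℕ) (σ : RamState) (e f : Expr) :
    (e.entryAddr f).eval n σ = VCKernel.entryAddr n (e.eval n σ) (f.eval n σ) := rfl

@[simp] theorem Expr.eval_entry (n : ℕ) (σ : RamState) (e f : Expr) :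
    (e.entry f).eval n σ = σ.mem (VCKernel.entryAddr n (e.eval n σ) (f.eval n σ)) := rfl

/-- Variable `1` becomes the size of the vertex cover. -/
def countCover : Cmd :=
  .seq (.assign 1 (.lit 0)) (.forAll 4 (.assign 1 (.add (.var 1) (Expr.cover (.var 4)))))

theorem run_countCover (n : ℕ) (σ : RamState) :
    (countCover.run n σ).reg 1 = ∑ i ∈ Finset.range n, σ.mem (2 + i) ∧
      (countCover.run n σ).mem = σ.mem := by
  refine Cmd.run_forAll_induction (fun i τ => τ.reg 1 = ∑ i ∈ Finset.range i, σ.mem (2 + i) ∧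
      τ.mem = σ.mem) (by simp ) fun i _ τ h => ?_
  simp [h, Finset.sum_range_succ]

/-- Multiplies variable `2` by the size of the vertex cover. -/
def mulCover : Cmd :=
  .seq (.assign 3 (.lit 0)) (.seq
    (.forAll 4 (.ite (Expr.cover (.var 4)) (.assign 3 (.add (.var 3) (.var 2))) .skip))
    (.assign 2 (.var 3)))

theorem run_mulCover (n : ℕ) (σ : RamState) (hσ : ∀ i < n, σ.mem (2 + i) ≤ 1) :
    (mulCover.run n σ).reg 2 = σ.reg 2 * ∑ i ∈ Finset.range n, σ.mem (2 + i) ∧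
      (mulCover.run n σ).mem = σ.mem := by
  have := Cmd.run_forAll_induction (n := n) (v := 4)
    (C := .ite (Expr.cover (.var 4)) (.assign 3 (.add (.var 3) (.var 2))) .skip)
    (σ := σ.setReg 3 0) (fun i τ => τ.reg 3 = σ.reg 2 * ∑ i ∈ Finset.range i, σ.mem (2 + i) ∧
      τ.reg 2 = σ.reg 2 ∧ τ.mem = σ.mem) (by simp) fun i hi τ h => by
    rcases Nat.le_one_iff_eq_zero_or_eq_one.1 (hσ i hi) with h0 | h1
    · simp [h, Finset.sum_range_succ, h0]
    · simp [h, Finset.sum_range_succ, h1, mul_add]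
  simpa only [mulCover, Cmd.run_seq, Cmd.run_assign, Expr.eval, RamState.setReg_reg, if_true,
    RamState.setReg_mem] using And.intro this.1 this.2.2

/-- Variable `2` becomes `A * x ^ d`, where `x` is the size of the vertex cover. -/
def powCover (A : ℕ) : ℕ → Cmd
  | 0 => .assign 2 (.lit A)
  | d + 1 => .seq (powCover A d) mulCover

theorem run_powCover (A d n : ℕ) (σ : RamState) (hσ : ∀ i < n, σ.mem (2 + i) ≤ 1) :
    ((powCover A d).run n σ).reg 2 = A * (∑ i ∈ Finset.range n, σ.mem (2 + i)) ^ d ∧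
      ((powCover A d).run n σ).mem = σ.mem := by
  induction d with
  | zero => simp [powCover]
  | succ d ih =>
    have := run_mulCover n ((powCover A d).run n σ) (by rwa [ih.2])
    rw [ih.1, ih.2] at this
    simpa [powCover, Cmd.run, pow_succ, mul_assoc] using this

/-- Variable `7` becomes `1` or `0`, according to whether the vertices in the variables `4` and `5`
have the same adjacencies to the vertices in the `c` variables from `8` on. -/
def compareRows : ℕ → Cmd
  | 0 => .assign 7 (.lit 1)
  | c + 1 => .seq (compareRows c) (.ite
      (.add (.sub (Expr.entry (.var (8 + c)) (.var 5)) (Expr.entry (.var (8 + c)) (.var 4)))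
        (.sub (Expr.entry (.var (8 + c)) (.var 4)) (Expr.entry (.var (8 + c)) (.var 5))))
      (.assign 7 (.lit 0)) .skip)

open Classical in
theorem run_compareRows (c n : ℕ) (σ : RamState) :
    (compareRows c).run n σ = σ.setReg 7
      (if ∀ j < c, σ.mem (entryAddr n (σ.reg (8 + j)) (σ.reg 5)) =
        σ.mem (entryAddr n (σ.reg (8 + j)) (σ.reg 4)) then 1 else 0) := by
  induction c with
  | zero => simp [compareRows]
  | succ c ih =>
    have h8 : 8 + c ≠ 7 := by omega
    have hsub : ∀ a b : ℕ, a - b + (b - a) = 0 ↔ a = b := by omega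
    simp only [compareRows, Cmd.run_skip, Cmd.run_assign, Cmd.run_seq, Cmd.run_ite, ih, Expr.eval,
      Expr.eval_entry, RamState.setReg_reg, h8, if_false, RamState.setReg_mem, ne_eq, hsub, ite_not,
      Nat.lt_succ_iff_lt_or_eq, or_imp, forall_and, forall_eq]
    by_cases h : σ.mem (entryAddr n (σ.reg (8 + c)) (σ.reg 5)) =
      σ.mem (entryAddr n (σ.reg (8 + c)) (σ.reg 4))
    · simp [h]
    · simp [h, RamState.setReg]

open Classical in
/-- The number of vertices before `v` outside the vertex cover that have the same adjacencies as
`v` to the vertices `y 0, …, y (c - 1)`, read from the memory `m` that holds an instance. -/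
noncomputable def memRank (n : ℕ) (m : ℕ → ℕ) (c : ℕ) (y : ℕ → ℕ) (v : ℕ) : ℕ :=
  ((Finset.range n).filter fun u => u < v ∧ m (2 + u) = 0 ∧
    ∀ j < c, m (entryAddr n (y j) u) = m (entryAddr n (y j) v)).card

theorem memRank_congr {n : ℕ} {m : ℕ → ℕ} {c : ℕ} {y z : ℕ → ℕ} {v : ℕ}
    (h : ∀ j < c, y j = z j) : memRank n m c y v = memRank n m c z v := by
  unfold memRank
  congr 1
  refine Finset.filter_congr fun u _ => ?_
  refine and_congr_right fun _ => and_congr_right fun _ => forall₂_congr fun j hj => ?_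
  rw [h j hj]

/-- Sets variable `6` if the vertex in variable `4` has rank less than the number in variable `2`
with respect to the tuple in the `c` variables from `8` on. -/
def testTuple (c : ℕ) : Cmd :=
  .seq (.assign 3 (.lit 0)) (.seq
    (.forAll 5 (.ite (.sub (.var 4) (.var 5)) (.ite (Expr.cover (.var 5)) .skip
      (.seq (compareRows c) (.assign 3 (.add (.var 3) (.var 7))))) .skip))
    (.ite (.sub (.var 2) (.var 3)) (.assign 6 (.lit 1)) .skip))

theorem run_testTuple (c n : ℕ) (σ : RamState) :
    (((testTuple c).run n σ).reg 6 ≠ 0 ↔ σ.reg 6 ≠ 0 ∨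
      memRank n σ.mem c (fun j => σ.reg (8 + j)) (σ.reg 4) < σ.reg 2) ∧
    ((testTuple c).run n σ).mem = σ.mem ∧
    ∀ r, r ≠ 3 → r ≠ 5 → r ≠ 6 → r ≠ 7 → ((testTuple c).run n σ).reg r = σ.reg r := by
  classical
  have := Cmd.run_forAll_induction (n := n) (v := 5)
    (C := .ite (.sub (.var 4) (.var 5)) (.ite (Expr.cover (.var 5)) .skip
      (.seq (compareRows c) (.assign 3 (.add (.var 3) (.var 7))))) .skip)
    (σ := σ.setReg 3 0) (fun i τ => τ.reg 3 = ((Finset.range i).filter fun u =>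
        u < σ.reg 4 ∧ σ.mem (2 + u) = 0 ∧ ∀ j < c, σ.mem (entryAddr n (σ.reg (8 + j)) u) =
          σ.mem (entryAddr n (σ.reg (8 + j)) (σ.reg 4))).card ∧
      τ.mem = σ.mem ∧ ∀ r, r ≠ 3 → r ≠ 5 → r ≠ 7 → τ.reg r = σ.reg r) (by simp +contextual)
      fun i hi τ ⟨h3, hm, hr⟩ => by
    have h8 : ∀ j, 8 + j ≠ 5 := by omega
    have h8' : ∀ j, τ.reg (8 + j) = σ.reg (8 + j) := fun j => hr _ (by omega) (by omega) (by omega)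
    simp only [Cmd.run_skip, Cmd.run_assign, Cmd.run_seq, Cmd.run_ite, Expr.eval, run_compareRows,
      Expr.eval_cover, RamState.setReg_reg, RamState.setReg_mem, hm, h8, h8', if_false, if_true,
      ne_eq, hr 4 (by decide) (by decide) (by decide), Finset.range_add_one, Finset.filter_insert,
      Nat.reduceEqDiff, Nat.sub_eq_zero_iff_le, not_le]
    by_cases h1 : i < σ.reg 4
    · by_cases h2 : σ.mem (2 + i) = 0
      · by_cases h4 : ∀ j < c, σ.mem (entryAddr n (σ.reg (8 + j)) i) =
          σ.mem (entryAddr n (σ.reg (8 + j)) (σ.reg 4))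
        · rw [if_pos h1, if_neg (not_not.2 h2), if_pos h4, if_pos ⟨h1, h2, h4⟩,
            Finset.card_insert_of_notMem (by simp)]
          simp +contextual [h3, hm, hr]
        · rw [if_pos h1, if_neg (not_not.2 h2), if_neg h4, if_neg (fun h => h4 h.2.2)]
          simp +contextual [h3, hm, hr]
      · rw [if_pos h1, if_pos h2, if_neg (fun h => h2 h.2.1)]
        simp +contextual [h3, hm, hr]
    · rw [if_neg h1, if_neg (fun h => h1 h.1)]
      simp +contextual [h3, hm, hr]
  simp only [testTuple, Cmd.run_assign, Cmd.run_seq, Expr.eval]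
  generalize Cmd.run n (.forAll 5 _) _ = τ at *
  obtain ⟨h3, hm, hr⟩ := this
  have h2 : τ.reg 2 = σ.reg 2 := hr 2 (by decide) (by decide) (by decide)
  have h6 : τ.reg 6 = σ.reg 6 := hr 6 (by decide) (by decide) (by decide)
  have hrank : τ.reg 3 = memRank n σ.mem c (fun j => σ.reg (8 + j)) (σ.reg 4) := h3
  rw [← hrank]
  rw [Cmd.run_ite, show (Expr.sub (.var 2) (.var 3)).eval n τ = τ.reg 2 - τ.reg 3 from rfl]
  by_cases h : τ.reg 3 < σ.reg 2
  · rw [if_pos (by omega)]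
    refine ⟨by simp [h], by simp [hm], fun r h3 h5 h6 h7 => ?_⟩
    simp [h6, hr r h3 h5 h7]
  · rw [if_neg (by omega)]
    exact ⟨by simp [h, h6], hm, fun r h3 h5 _ h7 => hr r h3 h5 h7⟩

/-- Tests all tuples that differ from the one in the `c` variables from `8` on only in the first
`i` entries, where these entries run over the vertex cover. -/
def testTuples (c : ℕ) : ℕ → Cmd
  | 0 => testTuple c
  | i + 1 => .forAll (8 + i) (.ite (Expr.cover (.var (8 + i))) (testTuples c i) .skip)

theorem run_testTuples (c n i : ℕ) : ∀ σ : RamState,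
    (((testTuples c i).run n σ).reg 6 ≠ 0 ↔ σ.reg 6 ≠ 0 ∨
      ∃ y : ℕ → ℕ, (∀ j < i, y j < n ∧ σ.mem (2 + y j) ≠ 0) ∧ (∀ j ≥ i, y j = σ.reg (8 + j)) ∧
        memRank n σ.mem c y (σ.reg 4) < σ.reg 2) ∧
    ((testTuples c i).run n σ).mem = σ.mem ∧
    ∀ r, r ≠ 3 → r ≠ 5 → r ≠ 6 → r ≠ 7 → (r < 8 ∨ 8 + i ≤ r) →
      ((testTuples c i).run n σ).reg r = σ.reg r := by
  induction i with
  | zero =>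
    intro σ
    obtain ⟨h6, hm, hr⟩ := run_testTuple c n σ
    refine ⟨h6.trans (or_congr_right ⟨fun h => ⟨_, by simp, fun _ _ => rfl, h⟩, ?_⟩), hm,
      fun r h3 h5 h6 h7 _ => hr r h3 h5 h6 h7⟩
    rintro ⟨y, -, hy, h⟩
    obtain rfl : y = fun j => σ.reg (8 + j) := funext fun j => hy j (by omega)
    exact h
  | succ i ih =>
    intro σ
    have := Cmd.run_forAll_induction (n := n) (v := 8 + i)
      (C := .ite (Expr.cover (.var (8 + i))) (testTuples c i) .skip) (σ := σ)
      (fun b τ => (τ.reg 6 ≠ 0 ↔ σ.reg 6 ≠ 0 ∨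
        ∃ y : ℕ → ℕ, (∀ j < i, y j < n ∧ σ.mem (2 + y j) ≠ 0) ∧
          (y i < b ∧ σ.mem (2 + y i) ≠ 0) ∧ (∀ j ≥ i + 1, y j = σ.reg (8 + j)) ∧
          memRank n σ.mem c y (σ.reg 4) < σ.reg 2) ∧
        τ.mem = σ.mem ∧ ∀ r, r ≠ 3 → r ≠ 5 → r ≠ 6 → r ≠ 7 → (r < 8 ∨ 8 + (i + 1) ≤ r) →
          τ.reg r = σ.reg r) (by simp) fun b hb τ ⟨h6, hm, hr⟩ => by
      have hlast : ∀ y : ℕ → ℕ, (y i < b + 1 ∧ σ.mem (2 + y i) ≠ 0) ↔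
          (y i < b ∧ σ.mem (2 + y i) ≠ 0) ∨ (y i = b ∧ σ.mem (2 + b) ≠ 0) := fun y => by
        rw [Nat.lt_succ_iff_lt_or_eq, or_and_right]
        exact or_congr_right (and_congr_right fun h => by rw [h])
      by_cases hX : σ.mem (2 + b) = 0
      · simp only [hlast, hX, Cmd.run_skip, Cmd.run_ite, Expr.eval_cover, Expr.eval,
          RamState.setReg_reg, RamState.setReg_mem, hm, if_true, ne_eq, not_true_eq_false,
          and_false, or_false, if_false, true_and]
        have : 6 ≠ 8 + i := by omega
        refine ⟨by simpa [this] using h6, fun r h3 h5 h6 h7 h8 => ?_⟩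
        rw [if_neg (by omega), hr r h3 h5 h6 h7 h8]
      · obtain ⟨h6', hm', hr'⟩ := ih (τ.setReg (8 + i) b)
        have hrun : (Cmd.ite (Expr.cover (.var (8 + i))) (testTuples c i) .skip).run n
            (τ.setReg (8 + i) b) = (testTuples c i).run n (τ.setReg (8 + i) b) := by
          simp [hm, hX]
        rw [hrun]
        have e2 : 2 ≠ 8 + i := by omega
        have e4 : 4 ≠ 8 + i := by omega
        have e6 : 6 ≠ 8 + i := by omega
        refine ⟨h6'.trans ?_, by rw [hm', RamState.setReg_mem, hm], fun r h3 h5 h6 h7 h8 => ?_⟩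
        · simp only [RamState.setReg_reg, RamState.setReg_mem, e2, e4, e6, if_false, h6, hm,
            hr 2 (by decide) (by decide) (by decide) (by decide) (by omega),
            hr 4 (by decide) (by decide) (by decide) (by decide) (by omega), hlast, or_assoc]
          refine or_congr_right ⟨?_, ?_⟩
          · rintro (⟨y, h1, h2, h3⟩ | ⟨y, h1, h2, h3⟩)
            · exact ⟨y, h1, .inl h2, h3⟩
            · refine ⟨y, h1, .inr ⟨by simpa using h2 i le_rfl, hX⟩, fun j hj => ?_, h3⟩
              rw [h2 j (by omega), if_neg (by omega), hr _ (by omega) (by omega) (by omega)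
                (by omega) (by omega)]
          · rintro ⟨y, h1, h2 | h2, h3, h4⟩
            · exact .inl ⟨y, h1, h2, h3, h4⟩
            · refine .inr ⟨y, h1, fun j hj => ?_, h4⟩
              split_ifs with hji
              · rw [← h2.1, show j = i by omega]
              · rw [h3 j (by omega), hr _ (by omega) (by omega) (by omega) (by omega) (by omega)]
        · rw [hr' r h3 h5 h6 h7 (by omega), RamState.setReg_reg, if_neg (by omega),
            hr r h3 h5 h6 h7 h8]
    obtain ⟨h6, hm, hr⟩ := this
    refine ⟨h6.trans (or_congr_right (exists_congr fun y => ?_)), hm, hr⟩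
    rw [← and_assoc]
    refine and_congr_left fun _ => ⟨fun h j hj => ?_,
      fun h => ⟨fun j hj => h j (by omega), h i (by omega)⟩⟩
    rcases Nat.lt_succ_iff_lt_or_eq.1 hj with h' | rfl
    · exact h.1 j h'
    · exact h.2

/-- The vertex `v` is marked, in terms of the memory `m` that holds an instance. -/
def MemMarked (n : ℕ) (m : ℕ → ℕ) (c l v : ℕ) : Prop :=
  m (2 + v) ≠ 0 ∨ ∃ y : ℕ → ℕ, (∀ j < c, y j < n ∧ m (2 + y j) ≠ 0) ∧ memRank n m c y v < l

/-- Writes the marks of all vertices behind the adjacency matrix. -/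
def markAll (c : ℕ) : Cmd :=
  .forAll 4 (.seq (.assign 6 (Expr.cover (.var 4)))
    (.seq (testTuples c c) (.store (Expr.entryAddr .size (.var 4)) (.var 6))))

/-- The marks depend only on the instance and not on the memory behind it. -/
theorem memMarked_congr {n : ℕ} {m m' : ℕ → ℕ} (h : ∀ a < 2 + n + n * n, m' a = m a) {c l v : ℕ}
    (hv : v < n) : MemMarked n m' c l v ↔ MemMarked n m c l v := by
  have hlt : ∀ {u}, u < n → m' (2 + u) = m (2 + u) := fun hu => h _ (by omega)
  have haddr : ∀ {i j}, i < n → j < n → m' (entryAddr n i j) = m (entryAddr n i j) :=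
    fun {i j} hi hj => h _ (by
      have : n * (i + 1) ≤ n * n := Nat.mul_le_mul_left n hi
      simp only [entryAddr]
      rw [mul_add] at this
      omega)
  unfold MemMarked memRank
  rw [hlt hv]
  refine or_congr_right (exists_congr fun y => ?_)
  have hy : (∀ j < c, y j < n ∧ m' (2 + y j) ≠ 0) ↔ (∀ j < c, y j < n ∧ m (2 + y j) ≠ 0) :=
    forall₂_congr fun j _ => and_congr_right fun h => by rw [hlt h]
  rw [hy]
  refine and_congr_right fun hy => ?_
  rw [iff_iff_eq]
  congr 2
  refine Finset.filter_congr fun u hu => ?_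
  rw [hlt (Finset.mem_range.1 hu)]
  refine and_congr_right fun _ => and_congr_right fun _ => forall₂_congr fun j hj => ?_
  rw [haddr (hy j hj).1 hv, haddr (hy j hj).1 (Finset.mem_range.1 hu)]

theorem run_markAll (c n : ℕ) (σ : RamState) :
    (∀ a < 2 + n + n * n, ((markAll c).run n σ).mem a = σ.mem a) ∧
    ∀ v < n, ((markAll c).run n σ).mem (entryAddr n n v) ≠ 0 ↔
      MemMarked n σ.mem c (σ.reg 2) v := by
  have := Cmd.run_forAll_induction (n := n) (v := 4)
    (C := .seq (.assign 6 (Expr.cover (.var 4)))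
      (.seq (testTuples c c) (.store (Expr.entryAddr .size (.var 4)) (.var 6)))) (σ := σ)
    (fun b τ => τ.reg 2 = σ.reg 2 ∧ (∀ a < 2 + n + n * n, τ.mem a = σ.mem a) ∧
      ∀ v < b, τ.mem (entryAddr n n v) ≠ 0 ↔ MemMarked n σ.mem c (σ.reg 2) v)
    (by simp) fun b hb τ ⟨h2, hm, hv⟩ => by
    obtain ⟨h6', hm', hr'⟩ := run_testTuples c n c ((τ.setReg 4 b).setReg 6 (τ.mem (2 + b)))
    simp only [Cmd.run_assign, Cmd.run_store, Cmd.run_seq, Expr.eval_cover, Expr.eval,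
      RamState.setReg_reg, if_true, RamState.setReg_mem, Expr.eval_entryAddr, RamState.setMem_mem,
      RamState.setMem_reg]
    rw [hr' 4 (by decide) (by decide) (by decide) (by decide) (by omega),
      hr' 2 (by decide) (by decide) (by decide) (by decide) (by omega), hm']
    simp only [RamState.setReg_reg, RamState.setReg_mem, Nat.reduceEqDiff,
      if_false, if_true, Function.update_apply]
    refine ⟨h2, fun a ha => ?_, fun v hvb => ?_⟩
    · rw [if_neg (by simp only [entryAddr]; omega), hm a ha]
    · rcases Nat.lt_succ_iff_lt_or_eq.1 hvb with h | rfl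
      · rw [if_neg (by simp only [entryAddr]; omega), hv v h]
      · rw [if_pos rfl, h6', ← memMarked_congr hm hb]
        simp only [RamState.setReg_reg, RamState.setReg_mem, Nat.reduceEqDiff,
          if_false, if_true, MemMarked, h2]
        refine or_congr_right ⟨?_, ?_⟩
        · rintro ⟨y, h1, -, h3⟩
          exact ⟨y, h1, h3⟩
        · rintro ⟨y, h1, h3⟩
          refine ⟨fun j => if j < c then y j else τ.reg (8 + j), fun j hj => ?_, fun j hj => ?_, ?_⟩
          · simpa [hj] using h1 j hj
          · beta_reduce
            rw [if_neg (by omega), if_neg (by omega), if_neg (by omega)]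
          · rwa [memRank_congr (z := y) fun j hj => if_pos hj]
  exact this.2

/-- The memory that agrees with `m` except that the list `w` is written to its beginning. -/
def overlay (w : List ℕ) (m : ℕ → ℕ) (a : ℕ) : ℕ := w[a]?.getD (m a)

theorem overlay_of_length_le {w : List ℕ} {m : ℕ → ℕ} {a : ℕ} (h : w.length ≤ a) :
    overlay w m a = m a := by
  simp [overlay, h]

theorem update_overlay (w : List ℕ) (m : ℕ → ℕ) (b : ℕ) :
    Function.update (overlay w m) w.length b = overlay (w ++ [b]) m := by
  ext a
  rw [Function.update_apply]
  split_ifs with h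
  · simp [overlay, h]
  · rcases lt_or_gt_of_ne h with h | h
    · simp [overlay, List.getElem?_append_left h]
    · rw [overlay_of_length_le h.le, overlay_of_length_le (by simpa using h)]

theorem ramOutputs_of_overlay {σ : RamState} {w : List ℕ} {m : ℕ → ℕ} (h0 : σ.reg 0 = w.length)
    (hm : σ.mem = overlay w m) : RamOutputs σ w :=
  ⟨h0, fun i hi => by simp [hm, overlay, hi]⟩

/-- Appends the value of an expression to the output. -/
def emit (e : Expr) : Cmd := .seq (.store (.var 0) e) (.assign 0 (.add (.var 0) (.lit 1)))

/-- Runs `C` for all marked vertices. -/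
def forMarked (v : ℕ) (C : Cmd) : Cmd :=
  .forAll v (.ite (Expr.entry .size (.var v)) C .skip)

/-- Writes the output. The output is a subsequence of the input, except for its first word, so
that it can overwrite the input from the left to the right while the input is read. -/
def writeOutput : Cmd :=
  .seq (.assign 3 (.lit 0)) (.seq (forMarked 4 (.assign 3 (.add (.var 3) (.lit 1))))
    (.seq (.store (.lit 0) (.var 3)) (.seq (.assign 0 (.lit 2))
    (.seq (forMarked 4 (emit (Expr.cover (.var 4))))
      (forMarked 4 (forMarked 5 (emit (Expr.entry (.var 4) (.var 5)))))))))

/-- A loop over the marked vertices that appends a bounded number of words for each of them. Here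
`d` is the number of words of the input read in each iteration, and `s` is the address where the
reading begins. -/
theorem run_forMarked {n v s d : ℕ} {C : Cmd} {σ : RamState} {w : List ℕ} {m : ℕ → ℕ}
    (hσ : σ.mem = overlay w m) (h0 : σ.reg 0 = w.length) (hw : w.length ≤ s)
    (hs : s + n * d ≤ 2 + n + n * n) (F : ℕ → List ℕ) (hF : ∀ i, (F i).length ≤ d)
    (Inv : RamState → Prop) (hInv : Inv σ) (hset : ∀ τ i, Inv τ → Inv (τ.setReg v i))
    (hv : v ≠ 0)
    (hC : ∀ i < n, ∀ τ : RamState, ∀ z : List ℕ, Inv τ → τ.reg v = i → τ.mem = overlay z m →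
      τ.reg 0 = z.length → z.length ≤ s + i * d →
      Inv (C.run n τ) ∧ (C.run n τ).mem = overlay (z ++ F i) m ∧
        (C.run n τ).reg 0 = (z ++ F i).length) :
    Inv ((forMarked v C).run n σ) ∧
    ((forMarked v C).run n σ).mem = overlay (w ++ ((List.range n).filter
      fun i => m (entryAddr n n i) ≠ 0).flatMap F) m ∧
    ((forMarked v C).run n σ).reg 0 = (w ++ ((List.range n).filter
      fun i => m (entryAddr n n i) ≠ 0).flatMap F).length := by
  have := Cmd.run_forAll_induction (n := n) (v := v)
    (C := .ite (Expr.entry .size (.var v)) C .skip) (σ := σ) (fun b τ => Inv τ ∧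
      (w ++ ((List.range b).filter fun i => m (entryAddr n n i) ≠ 0).flatMap F).length ≤ s + b * d ∧
      τ.mem = overlay (w ++ ((List.range b).filter
        fun i => m (entryAddr n n i) ≠ 0).flatMap F) m ∧
      τ.reg 0 = (w ++ ((List.range b).filter fun i => m (entryAddr n n i) ≠ 0).flatMap F).length)
    (by simpa [hInv, hσ, h0] using hw) fun b hb τ ⟨hI, hl, hm, hr⟩ => by
    rw [List.range_succ, List.filter_append, List.flatMap_append, ← List.append_assoc]
    set z := w ++ ((List.range b).filter fun i => m (entryAddr n n i) ≠ 0).flatMap F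
    -- the mark of `b` has not been overwritten yet
    have hzs : z.length ≤ entryAddr n n b := by
      have : b * d ≤ n * d := Nat.mul_le_mul_right d hb.le
      simp only [entryAddr]
      omega
    have hread : τ.mem (entryAddr n n b) = m (entryAddr n n b) := by
      rw [hm, overlay_of_length_le hzs]
    by_cases hmark : m (entryAddr n n b) = 0
    · simp only [Cmd.run_skip, Cmd.run_ite, Expr.eval, Expr.eval_entry, RamState.setReg_reg,
        RamState.setReg_mem, if_true, hread, hmark, ne_eq, not_true_eq_false, if_false,
        decide_false, Bool.false_eq_true, not_false_eq_true, List.filter_cons_of_neg,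
        List.filter_nil, List.flatMap_nil, List.append_nil, if_neg hv.symm]
      exact ⟨hset _ _ hI, by rw [add_mul]; omega, hm, hr⟩
    · have hrun : (Cmd.ite (Expr.entry .size (.var v)) C .skip).run n (τ.setReg v b) =
          C.run n (τ.setReg v b) := by
        simp [hread, hmark]
      rw [hrun]
      have hfil : ([b].filter fun i => m (entryAddr n n i) ≠ 0).flatMap F = F b := by
        simp [hmark]
      rw [hfil]
      obtain ⟨h1, h2, h3⟩ := hC b hb (τ.setReg v b) z (hset _ _ hI) (by simp) hm
        (by simpa [hv.symm] using hr) hl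
      refine ⟨h1, ?_, h2, h3⟩
      rw [List.length_append, add_mul, one_mul]
      have := hF b
      omega
  exact ⟨this.1, this.2.2⟩

theorem run_emit {n : ℕ} {e : Expr} {τ : RamState} {z : List ℕ} {m : ℕ → ℕ}
    (hm : τ.mem = overlay z m) (h0 : τ.reg 0 = z.length) :
    ((emit e).run n τ).mem = overlay (z ++ [e.eval n τ]) m ∧
      ((emit e).run n τ).reg 0 = (z ++ [e.eval n τ]).length ∧
      ∀ r ≠ 0, ((emit e).run n τ).reg r = τ.reg r := by
  simp +contextual [emit, RamState.setMem_mem, hm, h0, update_overlay]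

theorem run_writeOutput (n : ℕ) (σ : RamState) (L : List ℕ)
    (hL : L = (List.range n).filter fun i => σ.mem (entryAddr n n i) ≠ 0) :
    RamOutputs (writeOutput.run n σ) (L.length :: σ.mem 1 :: (L.map (fun i => σ.mem (2 + i)) ++
      (L.map fun i => L.map fun j => σ.mem (entryAddr n i j)).flatten)) := by
  set m := σ.mem with hm
  -- the number of marked vertices
  have hcount := Cmd.run_forAll_induction (n := n) (v := 4)
    (C := .ite (Expr.entry .size (.var 4)) (.assign 3 (.add (.var 3) (.lit 1))) .skip)
    (σ := σ.setReg 3 0) (fun b τ => τ.mem = m ∧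
      τ.reg 3 = ((List.range b).filter fun i => m (entryAddr n n i) ≠ 0).length)
    (by simp [hm]) fun b hb τ ⟨hm', h3⟩ => by
    rw [List.range_succ, List.filter_append, List.length_append]
    by_cases h : m (entryAddr n n b) = 0
    · simp [hm', h, h3]
    · simp [hm', h, h3]
  rw [← hL] at hcount
  simp only [writeOutput, Cmd.run_seq, Cmd.run_assign, Cmd.run_store, Expr.eval]
  rw [show forMarked 4 (.assign 3 (.add (.var 3) (.lit 1))) = .forAll 4 (.ite
    (Expr.entry .size (.var 4)) (.assign 3 (.add (.var 3) (.lit 1))) .skip) from rfl]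
  generalize Cmd.run n (.forAll 4 (.ite (Expr.entry .size (.var 4)) _ _)) _ = τ at hcount ⊢
  obtain ⟨hτ, h3⟩ := hcount
  have hhead : ((τ.setMem 0 (τ.reg 3)).setReg 0 2).mem = overlay [L.length, m 1] m := by
    funext a
    rcases a with _ | _ | a
    · simp [RamState.setMem_mem, overlay, h3]
    · simp [RamState.setMem_mem, overlay, hτ]
    · simp [RamState.setMem_mem, overlay, hτ]
  have h0 : ((τ.setMem 0 (τ.reg 3)).setReg 0 2).reg 0 = [L.length, m 1].length := by simp
  generalize (τ.setMem 0 (τ.reg 3)).setReg 0 2 = ρ at hhead h0 ⊢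
  have hlen : L.length ≤ n := by
    rw [hL]
    exact (List.length_filter_le _ _).trans (List.length_range).le
  -- the characteristic vector of the vertex cover
  obtain ⟨-, hm1, h01⟩ := run_forMarked (n := n) (v := 4) (s := 2) (d := 1)
    (C := emit (Expr.cover (.var 4))) hhead h0 le_rfl (by omega) (fun i => [m (2 + i)])
    (fun _ => le_rfl) (fun _ => True) trivial (fun _ _ _ => trivial) (by decide)
    fun i hi τ z _ h4 hτ hz hzl => by
      obtain ⟨h1, h2, -⟩ := run_emit (n := n) (e := Expr.cover (.var 4)) hτ hz
      have he : (Expr.cover (.var 4)).eval n τ = m (2 + i) := by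
        rw [Expr.eval_cover, Expr.eval, h4, hτ, overlay_of_length_le (by omega)]
      rw [he] at h1 h2
      exact ⟨trivial, h1, h2⟩
  rw [← hL] at hm1 h01
  -- the rows of the adjacency matrix
  obtain ⟨-, hm2, h02⟩ := run_forMarked (n := n) (v := 4) (s := 2 + n) (d := n)
    (C := forMarked 5 (emit (Expr.entry (.var 4) (.var 5)))) hm1 h01
    (by simp; omega) le_rfl
    (fun i => L.flatMap fun j => [m (entryAddr n i j)]) (fun i => by simpa using hlen)
    (fun _ => True) trivial (fun _ _ _ => trivial) (by decide)
    fun i hi τ z _ h4 hτ hz hzl => by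
      have hin : i * n + n ≤ n * n := by
        rw [← Nat.succ_mul]
        exact Nat.mul_le_mul_right n hi
      obtain ⟨-, h1, h2⟩ := run_forMarked (n := n) (v := 5) (s := 2 + n + i * n) (d := 1)
        (C := emit (Expr.entry (.var 4) (.var 5))) hτ hz hzl (by omega)
        (fun j => [m (entryAddr n i j)]) (fun _ => le_rfl) (fun τ => τ.reg 4 = i) h4
        (fun τ j h => by simpa using h) (by decide)
        fun j hj τ z h4 h5 hτ hz hzl => by
          obtain ⟨h1, h2, h3⟩ := run_emit (n := n) (e := Expr.entry (.var 4) (.var 5)) hτ hz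
          have he : (Expr.entry (.var 4) (.var 5)).eval n τ = m (entryAddr n i j) := by
            rw [Expr.eval_entry, Expr.eval, Expr.eval, h4, h5, hτ,
              overlay_of_length_le (by simp only [entryAddr]; rw [mul_comm n i]; omega)]
          rw [he] at h1 h2
          exact ⟨by rw [h3 4 (by decide), h4], h1, h2⟩
      rw [← hL] at h1 h2
      exact ⟨trivial, h1, h2⟩
  rw [← hL] at hm2 h02
  have hmap : ∀ g : ℕ → ℕ, L.flatMap (fun i => [g i]) = L.map g :=
    fun g => List.map_eq_flatMap.symm
  simp only [hmap] at h02 hm2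
  convert ramOutputs_of_overlay h02 hm2 using 1
  simp [List.flatMap_def]

/-- The kernelization algorithm. -/
def kernelCmd (c A d : ℕ) : Cmd :=
  .seq countCover (.ite (.sub (.var 1) (.mem (.lit 1)))
    (.seq (powCover A d) (.seq (.assign 2 (.add (.var 2) (.mem (.lit 1))))
      (.seq (markAll c) writeOutput)))
    (.seq (.store (.lit 0) (.lit 0)) (.seq (.store (.lit 1) (.lit 1)) (.assign 0 (.lit 2)))))

open Classical in
theorem run_kernelCmd (c A d n : ℕ) (σ : RamState) (hσ : ∀ i < n, σ.mem (2 + i) ≤ 1)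
    {x : ℕ} (hx : ∑ i ∈ Finset.range n, σ.mem (2 + i) = x) (L : List ℕ)
    (hL : L = (List.range n).filter fun v =>
      MemMarked n σ.mem c (A * x ^ d + σ.mem 1) v) :
    RamOutputs ((kernelCmd c A d).run n σ) (if σ.mem 1 < x then
      (L.length :: σ.mem 1 :: (L.map (fun i => σ.mem (2 + i)) ++
        (L.map fun i => L.map fun j => σ.mem (entryAddr n i j)).flatten)) else [0, 1]) := by
  obtain ⟨h1, hm1⟩ := run_countCover n σ
  rw [hx] at h1
  simp only [kernelCmd, Cmd.run_seq, Cmd.run_ite, Expr.eval, h1, hm1]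
  by_cases hk : σ.mem 1 < x
  · rw [if_pos hk]
    split_ifs with h'
    swap
    · omega
    obtain ⟨h2, hm2⟩ := run_powCover A d n (countCover.run n σ) (by rwa [hm1])
    rw [hm1, hx] at h2
    rw [hm1] at hm2
    simp only [Cmd.run_assign, Expr.eval, h2, hm2]
    obtain ⟨hm3, hmark⟩ := run_markAll c n
      (((powCover A d).run n (countCover.run n σ)).setReg 2 (A * x ^ d + σ.mem 1))
    simp only [RamState.setReg_mem, RamState.setReg_reg, if_true, hm2] at hm3 hmark
    generalize (markAll c).run n _ = τ at *
    have hlt : ∀ {v}, v ∈ L → v < n := fun hv => by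
      rw [hL, List.mem_filter, List.mem_range] at hv
      exact hv.1
    have hout := run_writeOutput n τ L (by
      rw [hL]
      refine List.filter_congr fun v hv => ?_
      rw [List.mem_range] at hv
      simp only [hmark v hv])
    rcases Nat.eq_zero_or_pos n with rfl | hn
    · simp at hx
      omega
    have hnn : n ≤ n * n := Nat.le_mul_self n
    have e1 : L.map (fun i => τ.mem (2 + i)) = L.map fun i => σ.mem (2 + i) :=
      List.map_congr_left fun i hi => hm3 _ (by have := hlt hi; omega)
    have e2 : (L.map fun i => L.map fun j => τ.mem (entryAddr n i j)) =
        L.map fun i => L.map fun j => σ.mem (entryAddr n i j) :=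
      List.map_congr_left fun i hi => List.map_congr_left fun j hj => hm3 _ (by
        have : n * (i + 1) ≤ n * n := Nat.mul_le_mul_left n (hlt hi)
        rw [mul_add] at this
        have := hlt hj
        simp only [entryAddr]
        omega)
    rw [hm3 1 (by omega), e1, e2] at hout
    exact hout
  · rw [if_neg hk]
    split_ifs with h'
    · omega
    refine ⟨by simp, fun i hi => ?_⟩
    have : i = 0 ∨ i = 1 := by simp at hi; omega
    rcases this with rfl | rfl
    · simp [RamState.setMem_mem]
    · simp [RamState.setMem_mem]

end VCKernel

/-! ### The kernelization of an instance -/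

namespace VCKernel

/-- The subinstance on the vertices in a list without duplicates, numbered in the order of the
list. -/
noncomputable def VCInstance.restrict (I : VCInstance) (L : List (Fin I.n)) : VCInstance where
  n := L.length
  G := I.G.comap L.get
  X := Finset.univ.filter fun i => L.get i ∈ I.X
  isVertexCover := fun i j hij => by simpa using I.isVertexCover hij
  k := I.k
  one_le_k := I.one_le_k

/-- The instance without vertices, which is a yes-instance for every property whose graphs have
edges. -/
def VCInstance.empty : VCInstance where
  n := 0
  G := ⊥
  X := ∅
  isVertexCover := fun i => i.elim0
  k := 1
  one_le_k := le_rfl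

/-- The list of the marked vertices. -/
noncomputable def VCInstance.markedList (I : VCInstance) (c l : ℕ) : List (Fin I.n) :=
  open Classical in (List.finRange I.n).filter fun v => Marked I.G I.X c l v

theorem VCInstance.mem_markedList {I : VCInstance} {c l : ℕ} {v : Fin I.n} :
    v ∈ I.markedList c l ↔ Marked I.G I.X c l v := by
  simp [markedList]

theorem VCInstance.nodup_markedList (I : VCInstance) (c l : ℕ) : (I.markedList c l).Nodup :=
  (List.nodup_finRange _).filter _

/-- The kernel: if `k` is at least the size `x` of the vertex cover, then the vertex cover is a
solution; otherwise the unmarked vertices are deleted. Here `A * x ^ d` stands for an upper bound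
on the number of vertices of the vertex-minimal induced subgraphs. -/
noncomputable def VCInstance.kernel (c A d : ℕ) (I : VCInstance) : VCInstance :=
  if I.k < I.param then I.restrict (I.markedList c (A * I.param ^ d + I.k)) else .empty

theorem ofFn_comp_get {α β : Type*} (L : List α) (g : α → β) :
    List.ofFn (fun i : Fin L.length => g (L.get i)) = L.map g := by
  refine List.ext_getElem (by simp) fun i h1 h2 => by simp

theorem VCInstance.mem_restrict_X {I : VCInstance} {L : List (Fin I.n)} (i : Fin L.length) :
    i ∈ (I.restrict L).X ↔ L.get i ∈ I.X := Finset.mem_filter_univ i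

open Classical in
theorem VCInstance.encode_restrict (I : VCInstance) (L : List (Fin I.n)) :
    (I.restrict L).encode = L.length :: I.k :: ((L.map fun i => if i ∈ I.X then 1 else 0) ++
      (L.map fun i => L.map fun j => if I.G.Adj i j then 1 else 0).flatten) := by
  rw [← ofFn_comp_get L fun i => if i ∈ I.X then 1 else 0,
    ← ofFn_comp_get L fun i => L.map fun j => if I.G.Adj i j then 1 else 0]
  simp only [← ofFn_comp_get L]
  refine congrArg (List.cons _) (congrArg (List.cons _) (congrArg₂ _ ?_ rfl))
  refine congrArg List.ofFn (funext fun i => ?_)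
  by_cases h : L.get i ∈ I.X
  · exact (if_pos ((mem_restrict_X i).2 h)).trans (if_pos h).symm
  · exact (if_neg fun h' => h ((mem_restrict_X i).1 h')).trans (if_neg h).symm

theorem VCInstance.encode_empty : VCInstance.empty.encode = [0, 1] := by
  simp [encode, empty]

theorem getElem?_flatten_of_length_eq {α : Type*} {n j : ℕ} (hj : j < n) (ls : List (List α))
    (h : ∀ l ∈ ls, l.length = n) (i : ℕ) :
    ls.flatten[n * i + j]? = ls[i]?.bind (·[j]?) := by
  induction ls generalizing i with
  | nil => simp
  | cons l ls ih =>
    have hl := h l (by simp)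
    cases i with
    | zero => simp [List.getElem?_append_left (hl ▸ hj : j < l.length)]
    | succ i =>
      rw [List.flatten_cons, List.getElem?_append_right (by rw [hl, mul_add]; omega), hl,
        show n * (i + 1) + j - n = n * i + j by rw [mul_add]; omega,
        ih fun l' hl' => h l' (by simp [hl'])]
      simp

section InputMemory

variable (I : VCInstance)

theorem VCInstance.mem_encode_one : (ramInput I.encode).mem 1 = I.k := by
  simp [ramInput, encode]

open Classical in
theorem VCInstance.mem_encode_cover (v : Fin I.n) :
    (ramInput I.encode).mem (2 + v) = if v ∈ I.X then 1 else 0 := by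
  simp [ramInput, encode, add_comm 2, List.getD_eq_getElem?_getD, List.getElem?_append]

open Classical in
theorem VCInstance.mem_encode_entry (u v : Fin I.n) :
    (ramInput I.encode).mem (entryAddr I.n u v) = if I.G.Adj u v then 1 else 0 := by
  have h : entryAddr I.n u v = (I.n + (I.n * u + v)) + 2 := by simp only [entryAddr]; omega
  simp only [ramInput, encode, h, List.getD_eq_getElem?_getD, List.getElem?_cons_succ]
  rw [List.getElem?_append_right (by simp), List.length_ofFn, Nat.add_sub_cancel_left,
    getElem?_flatten_of_length_eq v.2 _ (by simp [List.mem_ofFn])]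
  simp

theorem VCInstance.sum_mem_encode :
    ∑ i ∈ Finset.range I.n, (ramInput I.encode).mem (2 + i) = I.param := by
  classical
  rw [Finset.sum_range]
  simp [mem_encode_cover, param]

theorem VCInstance.memRank_encode {c : ℕ} (y : Fin c → Fin I.n) (z : ℕ → ℕ)
    (hyz : ∀ j : Fin c, z j = y j) (v : Fin I.n) :
    memRank I.n (ramInput I.encode).mem c z v =
      ((twins I.G I.X y v).filter (· < v)).card := by
  classical
  rw [← Finset.card_map Fin.valEmbedding, memRank]
  congr 1
  ext u
  have key : ∀ u : Fin I.n, ((u : ℕ) < v ∧ (ramInput I.encode).mem (2 + u) = 0 ∧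
      ∀ j < c, (ramInput I.encode).mem (entryAddr I.n (z j) u) =
        (ramInput I.encode).mem (entryAddr I.n (z j) v)) ↔ u ∈ twins I.G I.X y v ∧ u < v := by
    intro u
    have h3 : (∀ j < c, (ramInput I.encode).mem (entryAddr I.n (z j) u) =
        (ramInput I.encode).mem (entryAddr I.n (z j) v)) ↔
        ∀ i, I.G.Adj (y i) u ↔ I.G.Adj (y i) v := by
      have : ∀ j : Fin c, (ramInput I.encode).mem (entryAddr I.n (z j) u) =
          (ramInput I.encode).mem (entryAddr I.n (z j) v) ↔
          (I.G.Adj (y j) u ↔ I.G.Adj (y j) v) := fun j => by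
        rw [hyz, mem_encode_entry, mem_encode_entry]
        split_ifs <;> simp [*]
      exact ⟨fun h i => (this i).1 (h i i.2), fun h j hj => (this ⟨j, hj⟩).2 (h _)⟩
    rw [h3, mem_encode_cover, mem_twins]
    simp
    tauto
  simp only [Finset.mem_filter, Finset.mem_range, Finset.mem_map, Fin.valEmbedding_apply]
  constructor
  · rintro ⟨hu, h⟩
    exact ⟨⟨u, hu⟩, (key ⟨u, hu⟩).1 h, rfl⟩
  · rintro ⟨w, hw, rfl⟩
    exact ⟨w.2, (key w).2 hw⟩

theorem VCInstance.memMarked_encode {c l : ℕ} (v : Fin I.n) :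
    MemMarked I.n (ramInput I.encode).mem c l v ↔ Marked I.G I.X c l v := by
  classical
  have hX : ∀ v : Fin I.n, (ramInput I.encode).mem (2 + v) ≠ 0 ↔ v ∈ I.X := fun v => by
    simp [mem_encode_cover]
  refine or_congr (hX v) ⟨?_, ?_⟩
  · rintro ⟨z, hz, h⟩
    refine ⟨fun j => ⟨z j, (hz j j.2).1⟩, fun j => (hX _).1 (hz j j.2).2, ?_⟩
    rwa [I.memRank_encode (fun j => ⟨z j, (hz j j.2).1⟩) z (fun _ => rfl)] at h
  · rintro ⟨y, hy, h⟩
    refine ⟨fun j => if hj : j < c then y ⟨j, hj⟩ else 0, fun j hj => ?_, ?_⟩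
    · simp only [hj, dif_pos]
      exact ⟨(y _).2, (hX _).2 (hy _)⟩
    · rwa [I.memRank_encode y _ fun j => by simp]

theorem VCInstance.filter_memMarked_encode {c l : ℕ} [DecidablePred
    (MemMarked I.n (ramInput I.encode).mem c l)] :
    (List.range I.n).filter (fun v => MemMarked I.n (ramInput I.encode).mem c l v) =
      (I.markedList c l).map Fin.val := by
  rw [← List.map_coe_finRange_eq_range, List.filter_map, markedList]
  congr 1
  refine List.filter_congr fun v _ => ?_
  simp [memMarked_encode]

end InputMemory

theorem VCInstance.length_encode (I : VCInstance) : I.encode.length = I.n + I.n * I.n + 2 := by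
  simp [encode, List.length_flatten, List.map_ofFn, Function.comp_def]

theorem length_le_bitLength (w : List ℕ) : w.length ≤ bitLength w := by
  induction w with
  | nil => simp [bitLength]
  | cons a w ih =>
    simp only [bitLength, List.map_cons, List.sum_cons, List.length_cons] at ih ⊢
    omega

theorem bitLength_le_of_forall_le_one (w : List ℕ) (hw : ∀ a ∈ w, a ≤ 1) :
    bitLength w ≤ 2 * w.length := by
  induction w with
  | nil => simp [bitLength]
  | cons a w ih =>
    have h1 : a.size ≤ 1 := Nat.size_le.2 (by have := hw a (by simp); omega)
    have h2 := ih fun b hb => hw b (by simp [hb])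
    simp only [bitLength, List.map_cons, List.sum_cons, List.length_cons] at h2 ⊢
    omega

theorem VCInstance.bitLength_encode_le (I : VCInstance) :
    bitLength I.encode ≤ I.n + I.k + 2 + 2 * (I.n + I.n * I.n) := by
  classical
  have hsize : ∀ a : ℕ, a.size ≤ a := fun a => Nat.size_le.2 Nat.lt_two_pow_self
  have h := bitLength_le_of_forall_le_one (I.encode.drop 2) (by
    simp only [encode, List.drop_succ_cons, List.drop_zero, List.mem_append, List.mem_ofFn,
      List.mem_flatten]
    rintro a (⟨i, rfl⟩ | ⟨l, ⟨i, rfl⟩, ha⟩)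
    · split_ifs <;> simp
    · obtain ⟨j, rfl⟩ := List.mem_ofFn.1 ha
      split_ifs <;> simp)
  rw [List.length_drop, length_encode] at h
  have h2 : bitLength I.encode =
      (I.n.size + 1) + ((I.k.size + 1) + bitLength (I.encode.drop 2)) := by
    simp [bitLength, encode]
  have := hsize I.n
  have := hsize I.k
  omega

theorem VCInstance.polyTimeComputable_kernel (c A d : ℕ) :
    PolyTimeComputable encode encode (kernel c A d) := by
  classical
  -- the size in the sense of the loop language is the number of vertices
  refine polyTimeComputable_of_cmd (kernelCmd c A d) VCInstance.n (fun I => rfl) (fun I => ?_)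
    fun I => ?_
  · have := length_le_bitLength I.encode
    rw [length_encode] at this
    omega
  · have hout := run_kernelCmd c A d I.n (ramInput I.encode) (fun i hi => by
      rw [I.mem_encode_cover ⟨i, hi⟩]
      split_ifs <;> simp) I.sum_mem_encode _ rfl
    convert hout using 1
    rw [kernel, mem_encode_one]
    split_ifs
    · rw [filter_memMarked_encode, encode_restrict]
      simp [Function.comp_def, mem_encode_cover, mem_encode_entry]
    · rw [encode_empty]

/-- A solution of a subinstance corresponds to a set of vertices of the whole instance that hits
all occurrences of the property within the subinstance. -/
theorem deletionToFree_restrict_iff (Pr : GraphProperty) (I : VCInstance) {L : List (Fin I.n)}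
    (hL : L.Nodup) : DeletionToFree Pr (I.restrict L) ↔ ∃ S : Finset (Fin I.n), S.card ≤ I.k ∧
      ∀ P : Finset (Fin I.n), (∀ v ∈ P, v ∈ L) → Disjoint P S →
        ¬ Pr.Holds (I.G.induce (P : Set (Fin I.n))) := by
  classical
  have hinj : Function.Injective L.get := List.nodup_iff_injective_get.1 hL
  have key : ∀ S : Finset (Fin L.length),
      Pr.InducedFree ((I.G.comap L.get).induce ((S : Set (Fin L.length))ᶜ)) ↔
      ∀ P : Finset (Fin I.n), (P : Set (Fin I.n)) ⊆ Set.range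
        ((Function.Embedding.subtype (· ∈ ((S : Set (Fin L.length))ᶜ))).trans ⟨L.get, hinj⟩) →
        ¬ Pr.Holds (I.G.induce (P : Set (Fin I.n))) := fun S =>
    Pr.inducedFree_comap_iff I.G
      ((Function.Embedding.subtype (· ∈ ((S : Set (Fin L.length))ᶜ))).trans ⟨L.get, hinj⟩)
  constructor
  · rintro ⟨S, hS, h⟩
    refine ⟨S.map ⟨L.get, hinj⟩, (Finset.card_map _).trans_le hS, fun P hP hPS => ?_⟩
    refine (key S).1 h P fun v hv => ?_
    obtain ⟨i, rfl⟩ := List.get_of_mem (hP v hv)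
    exact ⟨⟨i, fun hi => Finset.disjoint_left.1 hPS hv (Finset.mem_map.2 ⟨i, hi, rfl⟩)⟩, rfl⟩
  · rintro ⟨S, hS, h⟩
    let S' : Finset (Fin L.length) := Finset.univ.filter fun i => L.get i ∈ S
    have hS' : S'.card ≤ S.card :=
      Finset.card_le_card_of_injOn L.get (fun i hi => (Finset.mem_filter.1 hi).2) hinj.injOn
    refine ⟨S', hS'.trans hS, (key S').2 fun P hP => h P (fun v hv => ?_) ?_⟩
    · obtain ⟨i, rfl⟩ := hP hv
      exact List.get_mem _ _
    · refine Finset.disjoint_left.2 fun v hv hvS => ?_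
      obtain ⟨i, rfl⟩ := hP hv
      exact i.2 (Finset.mem_filter.2 ⟨Finset.mem_univ _, hvS⟩)

theorem deletionToFree_iff (Pr : GraphProperty) (I : VCInstance) :
    DeletionToFree Pr I ↔ ∃ S : Finset (Fin I.n), S.card ≤ I.k ∧
      ∀ P : Finset (Fin I.n), Disjoint P S → ¬ Pr.Holds (I.G.induce (P : Set (Fin I.n))) := by
  refine exists_congr fun S => and_congr_right fun _ => ?_
  refine (Pr.inducedFree_comap_iff I.G (Function.Embedding.subtype _)).trans
    (forall_congr' fun P => ?_)
  rw [← Finset.disjoint_coe, Set.disjoint_left]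
  simp [Set.subset_def]

theorem deletionToFree_kernel_iff {Pr : GraphProperty} {c : ℕ} {p : ℕ → ℕ}
    (hadj : Pr.CharacterizedByAdjacencies c)
    (hedge : ∀ (V : Type) [Finite V] (G : SimpleGraph V), Pr.Holds G → ∃ u v : V, G.Adj u v)
    (hmono : Monotone p)
    (hvc : ∀ (V : Type) [Finite V] (G : SimpleGraph V), Pr.VertexMinimal G →
      Nat.card V ≤ p G.vertexCoverNum.toNat) {A d : ℕ} (hp : ∀ x, 1 ≤ x → p x ≤ A * x ^ d)
    (I : VCInstance) : DeletionToFree Pr (I.kernel c A d) ↔ DeletionToFree Pr I := by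
  rw [VCInstance.kernel]
  split_ifs with hk
  · have hpos : 1 ≤ I.param := I.one_le_k.trans hk.le
    rw [deletionToFree_restrict_iff Pr I (I.nodup_markedList _ _), deletionToFree_iff]
    refine exists_congr fun S => and_congr_right fun hS => ⟨fun h => ?_, fun h P _ => h P⟩
    refine GraphProperty.not_holds_of_marked hadj hmono hvc I.isVertexCover
      (Finset.card_pos.1 hpos) (l := A * I.param ^ d + I.k) ?_
      fun P hP => h P fun v hv => VCInstance.mem_markedList.2 (hP v hv)
    have := hp _ hpos
    simp only [VCInstance.param] at this ⊢
    omega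
  · refine iff_of_true ((deletionToFree_iff _ _).2 ⟨∅, by simp, fun P _ hP => ?_⟩)
      ((deletionToFree_iff _ _).2 ⟨I.X, not_lt.1 hk, fun P hPX hP => ?_⟩)
    · obtain ⟨u, -⟩ := hedge _ _ hP
      exact u.1.elim0
    · obtain ⟨u, v, huv⟩ := hedge _ _ hP
      rcases I.isVertexCover huv with h | h
      · exact Finset.disjoint_left.1 hPX u.2 h
      · exact Finset.disjoint_left.1 hPX v.2 h

theorem VCInstance.n_kernel_le (c A d : ℕ) (I : VCInstance) :
    (I.kernel c A d).n ≤
      I.param + 2 ^ c * I.param ^ c * (A * I.param ^ d + I.param) := by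
  classical
  rw [kernel]
  split_ifs with hk
  · have h1 : (I.markedList c (A * I.param ^ d + I.k)).length =
        (Finset.univ.filter (Marked I.G I.X c (A * I.param ^ d + I.k))).card := by
      rw [← List.toFinset_card_of_nodup (I.nodup_markedList _ _)]
      congr 1
      ext v
      simp [mem_markedList]
    refine (h1.trans_le card_marked_le).trans ?_
    simp only [param] at hk ⊢
    gcongr
  · exact Nat.zero_le _

theorem VCInstance.k_kernel_le (c A d : ℕ) (I : VCInstance) :
    (I.kernel c A d).k ≤ I.param + 1 := by
  rw [kernel]
  split_ifs with hk
  · exact hk.le.trans (Nat.le_succ _)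
  · exact Nat.le_add_left _ _

/-- A natural-number-valued real polynomial has the order of magnitude of a monomial, unless it
is zero. This allows the algorithm to work with a monomial with a natural coefficient. The summand
`n` in the second bound is there because `p` may vanish at some small `n`. -/
theorem exists_monomial_bounds {p : ℕ → ℕ} {q : Polynomial ℝ}
    (hq : ∀ n : ℕ, (p n : ℝ) = q.eval (n : ℝ)) :
    ∃ A d C : ℕ, ∀ n, 1 ≤ n → p n ≤ A * n ^ d ∧ A * n ^ d ≤ C * (n + p n) := by
  by_cases h0 : q = 0
  · refine ⟨0, 0, 0, fun n _ => ?_⟩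
    have : (p n : ℝ) = 0 := by simp [hq, h0]
    simp_all
  have htend : Filter.Tendsto (fun n : ℕ => ((n + 1 : ℕ) : ℝ)) Filter.atTop Filter.atTop :=
    tendsto_natCast_atTop_atTop.comp (Filter.tendsto_add_atTop_nat 1)
  have hequiv := q.isEquivalent_atTop_lead
  have hlc : q.leadingCoeff ≠ 0 := Polynomial.leadingCoeff_ne_zero.2 h0
  have h1 : (fun n : ℕ => (p (n + 1) : ℝ)) =O[Filter.atTop]
      fun n : ℕ => ((n + 1 : ℕ) : ℝ) ^ q.natDegree := by
    simp only [hq]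
    exact (hequiv.isBigO.trans (Asymptotics.isBigO_const_mul_self _ _ _)).comp_tendsto htend
  have h2 : (fun n : ℕ => ((n + 1 : ℕ) : ℝ) ^ q.natDegree) =O[Filter.atTop]
      fun n : ℕ => ((n + 1 : ℕ) : ℝ) + p (n + 1) := by
    have h3 : (fun n : ℕ => ((n + 1 : ℕ) : ℝ) ^ q.natDegree) =O[Filter.atTop]
        fun n : ℕ => (p (n + 1) : ℝ) := by
      simp only [hq]
      exact ((Asymptotics.isBigO_self_const_mul hlc _ _).trans
        hequiv.isBigO_symm).comp_tendsto htend
    refine h3.trans (.of_bound 1 (.of_forall fun n => ?_))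
    rw [one_mul, Real.norm_of_nonneg (by positivity), Real.norm_of_nonneg (by positivity)]
    have : (0 : ℝ) ≤ ((n + 1 : ℕ) : ℝ) := by positivity
    linarith
  rw [Asymptotics.isBigO_nat_atTop_iff fun n h => absurd h (by positivity)] at h1 h2
  obtain ⟨C₁, h1⟩ := h1
  obtain ⟨C₂, h2⟩ := h2
  refine ⟨⌈C₁⌉₊, q.natDegree, ⌈C₁⌉₊ * ⌈C₂⌉₊, fun n hn => ?_⟩
  obtain ⟨n, rfl⟩ := Nat.exists_eq_add_of_le' hn
  have b1 := h1 n
  have b2 := h2 n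
  rw [Real.norm_of_nonneg (by positivity), Real.norm_of_nonneg (by positivity)] at b1 b2
  have c1 : p (n + 1) ≤ ⌈C₁⌉₊ * (n + 1) ^ q.natDegree := by
    have := b1.trans (mul_le_mul_of_nonneg_right (Nat.le_ceil C₁) (by positivity))
    exact_mod_cast this
  have c2 : (n + 1) ^ q.natDegree ≤ ⌈C₂⌉₊ * (n + 1 + p (n + 1)) := by
    have := b2.trans (mul_le_mul_of_nonneg_right (Nat.le_ceil C₂) (by positivity))
    exact_mod_cast this
  exact ⟨c1, by rw [mul_assoc]; exact Nat.mul_le_mul_left _ c2⟩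

end VCKernel

theorem theorem3p1 (Pr : VCKernel.GraphProperty) (c : ℕ) (p : ℕ → ℕ)
    (hadj : Pr.CharacterizedByAdjacencies c)
    (hedge : ∀ (V : Type) [Finite V] (G : SimpleGraph V), Pr.Holds G → ∃ u v : V, G.Adj u v)
    (hmono : Monotone p)
    (hpoly : ∃ q : Polynomial ℝ, ∀ n : ℕ, (p n : ℝ) = q.eval (n : ℝ))
    (hvc : ∀ (V : Type) [Finite V] (G : SimpleGraph V), Pr.VertexMinimal G →
      Nat.card V ≤ p G.vertexCoverNum.toNat) :
    ∃ (f : VCKernel.VCInstance → VCKernel.VCInstance) (C : ℕ),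
      VCKernel.IsPolyKernelization VCKernel.VCInstance.encode VCKernel.VCInstance.param
        (VCKernel.DeletionToFree Pr) f ∧
      ∀ I : VCKernel.VCInstance,
        (f I).n ≤ C * ((I.param + p I.param) * I.param ^ c) := by
  open VCKernel VCInstance in
  obtain ⟨q, hq⟩ := hpoly
  obtain ⟨A, d, C, hA⟩ := exists_monomial_bounds hq
  refine ⟨kernel c A d, 1 + 2 ^ c * C + 2 ^ c,
    ⟨polyTimeComputable_kernel c A d,
      deletionToFree_kernel_iff hadj hedge hmono hvc fun x hx => (hA x hx).1, ?_⟩, fun I => ?_⟩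
  · -- `N` bounds the number of vertices of the kernel
    let N : Polynomial ℕ := .X + 2 ^ c * .X ^ c * (.C A * .X ^ d + .X)
    refine ⟨N + (.X + 1) + 2 + 2 * (N + N * N), fun I => ?_⟩
    have hN : (I.kernel c A d).n ≤ N.eval I.param := by
      simpa [N] using n_kernel_le c A d I
    have hk := k_kernel_le c A d I
    have hX : (I.kernel c A d).param ≤ (I.kernel c A d).n :=
      (Finset.card_le_univ _).trans (Fintype.card_fin _).le
    have hNN := Nat.mul_le_mul hN hN
    have hlen := (I.kernel c A d).bitLength_encode_le
    simp only [Polynomial.eval_add, Polynomial.eval_mul, Polynomial.eval_X, Polynomial.eval_one,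
      Polynomial.eval_ofNat]
    generalize N.eval I.param = M at *
    constructor <;> omega
  · rcases Nat.eq_zero_or_pos I.param with h0 | hpos
    · -- a given vertex cover that is empty leads to the empty instance, because `1 ≤ k`
      rw [kernel, if_neg (by omega)]
      exact Nat.zero_le _
    · refine (n_kernel_le c A d I).trans ?_
      have h1 := (hA _ hpos).2
      have h2 : 1 ≤ I.param ^ c := Nat.one_le_pow _ _ hpos
      generalize I.param ^ c = y at *
      generalize A * I.param ^ d = a at *
      generalize I.param = x at *
      calc x + 2 ^ c * y * (a + x)
          ≤ (x + p x) * y + 2 ^ c * y * (C * (x + p x) + (x + p x)) := by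
            gcongr
            · exact (Nat.le_add_right _ _).trans (Nat.le_mul_of_pos_right _ h2)
            · exact Nat.le_add_right _ _
        _ = (1 + 2 ^ c * C + 2 ^ c) * ((x + p x) * y) := by ring
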